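/- **Setting.** Define the spectral density on $\mathbb{R}\setminus\{0\}$ $$Q(\omega)=\frac{\frac14\log\log\pi}{|\omega|\,\bigl(1+\frac{|\omega|^2}{4\pi^2}\bigr)^{1/4}\,\log\bigl(\pi+|\omega|^{-1/2}\bigr)\,\bigl(\log\log(\pi+|\omega|^{-1/2})\bigr)^2},$$ the translation invariant kernel $k(s,t)=\int_{\mathbb{R}}Q(\omega)e^{-2\pi i\omega(s-t)}\,d\omega$ on $\mathbb{R}$ (so $k(t,t)=k(0,0)$), its reproducing kernel Hilbert space $\mathcal{H}$ and the feature map $\phi(t)=k(t,\cdot)\in\mathcal{H}$. Let $\mathcal{L}(\mathcal{H},\mathbb{R}^d)$ be the Hilbert space of operators $\mathcal{H}\to\mathbb{R}^d$ with the Hilbert–Schmidt norm, $\mathbb{R}^d$ being Euclidean. **Algorithm.** Fix $d\in\mathbb{N}$, $G>0$ and $\varepsilon>0$ and put $G_0=G\sqrt{k(0,0)}$ and $$\Psi(S,V)=\frac{\varepsilon G_0}{\sqrt V\log^2(V/G_0^2)}\begin{cases}\exp\bigl(\frac{S^2}{36V}\bigr)-1,& S\le 6V/G_0,\\ \exp\bigl(\frac{S}{3G_0}-\frac{V}{G_0^2}\bigr)-1,&\text{otherwise.}\end{cases}$$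 In round $t=1,2,\dots$, with $\Gamma_s=g_s\otimes\phi(s)$ for the gradients $g_1,\dots,g_{t-1}\in\mathbb{R}^d$ observed so far, let $\Theta_t=\sum_{s<t}\Gamma_s$ and $V_t=4G_0^2+\sum_{s<t}\|\Gamma_s\|^2$, let $$W_t=-\frac{\Theta_t}{\|\Theta_t\|}\,\Psi(\|\Theta_t\|,V_t)\in\mathcal{L}(\mathcal{H},\mathbb{R}^d)\qquad(W_t=0\text{ if }\Theta_t=0),$$ and play $w_t=W_t\phi(t)\in\mathbb{R}^d$; then $g_t$ is revealed and the loss $\langle g_t,w_t\rangle$ is incurred. (This is the parameter-free static online linear optimization algorithm run in $\mathcal{L}(\mathcal{H},\mathbb{R}^d)$.) **Theorem.** The algorithm is causal and horizon-free: $w_t$ depends only on $d,G,\varepsilon,t$ and $g_1,\dots,g_{t-1}$, and neither on the horizon $T$ nor on any restart schedule. Moreover there is an absolute constant $C>0$ such that for all $d$, $G>0$, $\varepsilon>0$, every integer $T>3$, every sequence $g_1,\dots,g_T\in\mathbb{R}^d$ with $\|g_t\|\le G$ and every comparator sequence $u_1,\dots,u_T\in\mathbb{R}^d$, the dynamic regret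 $R_T(u_1,\dots,u_T)=\sum_{t=1}^T\langle g_t,w_t-u_t\rangle$ satisfies $$R_T(u_1,\dots,u_T)\le C\Bigl(\varepsilon G+\ln(1+T)\,\ln\ln(1+T)\Bigl[\sqrt{\Lambda\,(M^2+MP_T)\textstyle\sum_{t=1}^T\|g_t\|^2}+\Lambda\, G\sqrt{M^2+MP_T}\Bigr]\Bigr),$$ where $M=\max_{1\le t\le T}\|u_t\|$, $P_T=\sum_{t=2}^T\|u_t-u_{t-1}\|$ and $\Lambda=\ln\bigl(e+MT^2/\varepsilon\bigr)$. That is, $R_T=\tilde{\mathcal{O}}\bigl(\sqrt{(M^2+MP_T)\sum_{t=1}^T\|g_t\|^2}\bigr)$, where $\tilde{\mathcal{O}}$ hides logarithmic factors in $T$ and $M/\varepsilon$, the start-up cost $\varepsilon G$ and the lower-order term of order $G\sqrt{M^2+MP_T}$. -/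

import Mathlib

open MeasureTheory
open scoped FourierTransform NNReal

noncomputable section

namespace KernelOLO

/-! ### The kernel -/

/-- The spectral density `Q`; its value at the single point `0` is immaterial. -/
def spectralDensity (ω : ℝ) : ℝ :=
  (1 / 4 * Real.log (Real.log Real.pi)) /
    (|ω| * (1 + |ω| ^ 2 / (4 * Real.pi ^ 2)) ^ (1 / 4 : ℝ) *
      Real.log (Real.pi + |ω| ^ (-(1 / 2) : ℝ)) *
      Real.log (Real.log (Real.pi + |ω| ^ (-(1 / 2) : ℝ))) ^ 2)

/-- The translation invariant kernel `k(s,t) = ∫ Q(ω) exp(-2πiω(s-t)) dω`. The integral is real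
because `Q` is even. -/
def kernel (s t : ℝ) : ℝ :=
  (𝓕 (fun ω : ℝ => (spectralDensity ω : ℂ)) (s - t)).re

/-- The scalar kernel `k` as an operator-valued kernel on the one-dimensional space `ℝ`. -/
def kernelMatrix : Matrix ℝ ℝ (ℝ →L[ℝ] ℝ) :=
  Matrix.of fun s t => kernel s t • ContinuousLinearMap.id ℝ ℝ

theorem spectralDensity_nonneg (ω : ℝ) : 0 ≤ spectralDensity ω := by
  have hpi : (3 : ℝ) < Real.pi := Real.pi_gt_three
  have h1 : 1 ≤ Real.log Real.pi := by
    rw [Real.le_log_iff_exp_le Real.pi_pos]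
    have := Real.exp_one_lt_d9
    linarith
  have h2 : 0 ≤ |ω| ^ (-(1 / 2) : ℝ) := by positivity
  have h3 : 0 ≤ Real.log (Real.pi + |ω| ^ (-(1 / 2) : ℝ)) := Real.log_nonneg (by linarith)
  have h4 : 0 ≤ Real.log (Real.log Real.pi) := Real.log_nonneg h1
  unfold spectralDensity
  positivity

theorem fourier_integrand_re (ω x : ℝ) :
    (Real.fourierChar (-(ω * x)) • (spectralDensity ω : ℂ)).re =
      spectralDensity ω * Real.cos (2 * Real.pi * (ω * x)) := by
  rw [Circle.smul_def, Real.fourierChar_apply, smul_eq_mul, Complex.re_mul_ofReal]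
  rw [Complex.exp_ofReal_mul_I_re, mul_neg, Real.cos_neg, mul_comm]

theorem kernel_eq (hQ : Integrable spectralDensity) (s t : ℝ) :
    kernel s t = ∫ ω, spectralDensity ω * Real.cos (2 * Real.pi * (ω * (s - t))) := by
  have hi : Integrable fun ω : ℝ =>
      Real.fourierChar (-(ω * (s - t))) • (spectralDensity ω : ℂ) := by
    have := (Real.fourierIntegral_convergent_iff (f := fun ω : ℝ => (spectralDensity ω : ℂ))
      (μ := volume) (s - t)).2 hQ.ofReal
    simpa [mul_comm] using this
  have h : kernel s t =
      (∫ ω : ℝ, Real.fourierChar (-(ω * (s - t))) • (spectralDensity ω : ℂ)).re := by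
    unfold kernel
    rw [Real.fourier_real_eq]
  rw [h]
  have := integral_re (𝕜 := ℂ) hi
  simp only [RCLike.re_eq_complex_re] at this
  rw [← this]
  simp only [fourier_integrand_re]

theorem kernel_eq_zero (hQ : ¬ Integrable spectralDensity) (s t : ℝ) : kernel s t = 0 := by
  have h : ¬ Integrable fun ω : ℝ =>
      Real.fourierChar (-(ω * (s - t))) • (spectralDensity ω : ℂ) := by
    intro h
    apply hQ
    have h2 := (Real.fourierIntegral_convergent_iff (f := fun ω : ℝ => (spectralDensity ω : ℂ))
      (μ := volume) (s - t)).1 (by simpa [mul_comm] using h)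
    simpa using h2.re
  unfold kernel
  rw [Real.fourier_real_eq, integral_undef h, Complex.zero_re]

theorem kernel_diag (t : ℝ) : kernel t t = kernel 0 0 := by simp [kernel]

theorem kernel_symm (s t : ℝ) : kernel s t = kernel t s := by
  by_cases hQ : Integrable spectralDensity
  · rw [kernel_eq hQ, kernel_eq hQ]
    congr 1
    ext ω
    rw [← Real.cos_neg]
    congr 2
    ring
  · rw [kernel_eq_zero hQ, kernel_eq_zero hQ]

theorem kernel_sum_nonneg (c : ℝ →₀ ℝ) :
    0 ≤ c.sum fun x w => c.sum fun x' w' => kernel x' x * w * w' := by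
  by_cases hQ : Integrable spectralDensity
  · have hi (a b : ℝ) (x x' : ℝ) : Integrable fun ω =>
        spectralDensity ω * Real.cos (2 * Real.pi * (ω * (x' - x))) * a * b := by
      apply Integrable.mul_const
      apply Integrable.mul_const
      refine hQ.mul_bdd (c := 1) (by fun_prop) (Filter.Eventually.of_forall fun ω => ?_)
      rw [Real.norm_eq_abs]
      exact Real.abs_cos_le_one _
    have h : (c.sum fun x w => c.sum fun x' w' => kernel x' x * w * w') =
        ∫ ω, c.sum fun x w => c.sum fun x' w' =>
          spectralDensity ω * Real.cos (2 * Real.pi * (ω * (x' - x))) * w * w' := by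
      simp only [Finsupp.sum]
      rw [integral_finsetSum _ fun x _ => integrable_finsetSum _ fun x' _ => hi _ _ _ _]
      refine Finset.sum_congr rfl fun x _ => ?_
      rw [integral_finsetSum _ fun x' _ => hi _ _ _ _]
      refine Finset.sum_congr rfl fun x' _ => ?_
      rw [integral_mul_const, integral_mul_const, kernel_eq hQ]
    rw [h]
    refine integral_nonneg fun ω => ?_
    have h2 : (c.sum fun x w => c.sum fun x' w' =>
          spectralDensity ω * Real.cos (2 * Real.pi * (ω * (x' - x))) * w * w') =
        spectralDensity ω * ((c.sum fun x w => Real.cos (2 * Real.pi * (ω * x)) * w) ^ 2 +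
          (c.sum fun x w => Real.sin (2 * Real.pi * (ω * x)) * w) ^ 2) := by
      simp only [Finsupp.sum]
      rw [sq, sq, Finset.sum_mul_sum, Finset.sum_mul_sum, ← Finset.sum_add_distrib,
        Finset.mul_sum]
      refine Finset.sum_congr rfl fun x _ => ?_
      rw [← Finset.sum_add_distrib, Finset.mul_sum]
      refine Finset.sum_congr rfl fun x' _ => ?_
      rw [show 2 * Real.pi * (ω * (x' - x)) =
        2 * Real.pi * (ω * x') - 2 * Real.pi * (ω * x) by ring, Real.cos_sub]
      ring
    simp only [Pi.zero_apply]
    rw [h2]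
    have := spectralDensity_nonneg ω
    positivity
  · simp [kernel_eq_zero hQ]

theorem kernelMatrix_posSemidef : kernelMatrix.PosSemidef := by
  have h := (RKHS.posSemidef_tfae (K := kernelMatrix)).out 0 2
  refine h.2 ⟨?_, fun c => ?_⟩
  · ext s t
    simp [kernelMatrix, kernel_symm t s, ContinuousLinearMap.star_eq_adjoint,
      ContinuousLinearMap.adjoint_id]
  · have := kernel_sum_nonneg c
    simpa [kernelMatrix, mul_comm, mul_left_comm, mul_assoc] using this

instance : Fact kernelMatrix.PosSemidef := ⟨kernelMatrix_posSemidef⟩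

/-! ### The function space -/

/-- The reproducing kernel Hilbert space `H` of real functions on `ℝ` with kernel `k`. -/
abbrev Space : Type := RKHS.OfKernel kernelMatrix

/-- The feature map `φ(t) = k(t, ·) ∈ H`. -/
def feature (t : ℝ) : Space := RKHS.kerFun Space t 1

theorem inner_feature (s t : ℝ) : inner ℝ (feature s) (feature t) = kernel s t := by
  rw [feature, feature, ← RKHS.kernel_inner, RKHS.OfKernel.kernel_ofKernel]
  simp [kernelMatrix, kernel_symm t s]

/-- The operators `W : H → ℝ^d` with the Hilbert-Schmidt inner product: by Riesz representation,
`W = (⟨w₁, ·⟩, …, ⟨w_d, ·⟩)` with `w_i ∈ H`, and `‖W‖² = ∑ ‖w_i‖²`. -/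
abbrev OpSpace (d : ℕ) : Type := PiLp 2 fun _ : Fin d => Space

/-- `W φ(t) = (w₁(t), …, w_d(t))`. -/
def evalOp {d : ℕ} (W : OpSpace d) (t : ℝ) : EuclideanSpace ℝ (Fin d) :=
  WithLp.toLp 2 fun i => inner ℝ (W i) (feature t)

theorem evalOp_apply {d : ℕ} (W : OpSpace d) (t : ℝ) (i : Fin d) :
    evalOp W t i = (W i : Space) t := by
  simp [evalOp, feature]

/-- The rank-one operator `g ⊗ φ(t)`, that is, `h ↦ ⟨φ(t), h⟩ g`. -/
def tensorFeature {d : ℕ} (g : EuclideanSpace ℝ (Fin d)) (t : ℝ) : OpSpace d :=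
  WithLp.toLp 2 fun i => g i • feature t

/-! ### The parameter-free static algorithm on a Hilbert space -/

section Static

variable {E : Type*} [NormedAddCommGroup E] [InnerProductSpace ℝ E]

/-- The potential `Ψ(S, V)` with parameters `ε` and `L` (a Lipschitz bound). -/
def potential (ε L S V : ℝ) : ℝ :=
  ε * L / (√V * Real.log (V / L ^ 2) ^ 2) *
    (if S ≤ 6 * V / L then Real.exp (S ^ 2 / (36 * V)) - 1
      else Real.exp (S / (3 * L) - V / L ^ 2) - 1)

/-- The iterate in round `t ≥ 1` against the linear losses `⟨Γ 1, ·⟩, ⟨Γ 2, ·⟩, …`: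
`- S / ‖S‖ * Ψ(‖S‖, V)` with `S = ∑_{s<t} Γ s` and `V = 4L² + ∑_{s<t} ‖Γ s‖²`
(and `0` when `S = 0`). -/
def staticIterate (ε L : ℝ) (Γ : ℕ → E) (t : ℕ) : E :=
  -((potential ε L ‖∑ s ∈ Finset.Ico 1 t, Γ s‖
      (4 * L ^ 2 + ∑ s ∈ Finset.Ico 1 t, ‖Γ s‖ ^ 2) / ‖∑ s ∈ Finset.Ico 1 t, Γ s‖) •
    ∑ s ∈ Finset.Ico 1 t, Γ s)

end Static

/-! ### The dynamic-regret algorithm -/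

/-- The point `w_t = W_t φ(t)` played in round `t`, where `W_t` is the iterate of the static
algorithm against `g_s ⊗ φ(s)`, `s < t`, with Lipschitz bound `G √(max_t k(t,t))`
(`k(t,t)` does not depend on `t`). -/
def play {d : ℕ} (ε G : ℝ) (g : ℕ → EuclideanSpace ℝ (Fin d)) (t : ℕ) :
    EuclideanSpace ℝ (Fin d) :=
  evalOp (staticIterate ε (G * √(kernel 0 0)) (fun s => tensorFeature (g s) (s : ℝ)) t) (t : ℝ)

/-- `R_T(u_1, …, u_T) = ∑_{t=1}^T (ℓ_t(w_t) - ℓ_t(u_t))` for the linear losses `ℓ_t = ⟨g_t, ·⟩`. -/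
def dynamicRegret {d : ℕ} (g w u : ℕ → EuclideanSpace ℝ (Fin d)) (T : ℕ) : ℝ :=
  ∑ t ∈ Finset.Icc 1 T, (inner ℝ (g t) (w t) - inner ℝ (g t) (u t))

/-- `M = max_{1 ≤ t ≤ T} ‖u_t‖`. -/
def maxNorm {d : ℕ} (u : ℕ → EuclideanSpace ℝ (Fin d)) (T : ℕ) : ℝ :=
  ((Finset.Icc 1 T).sup fun t => ‖u t‖₊ : ℝ≥0)

/-- The path length `P_T = ∑_{t=2}^T ‖u_t - u_{t-1}‖`. -/
def pathLength {d : ℕ} (u : ℕ → EuclideanSpace ℝ (Fin d)) (T : ℕ) : ℝ :=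
  ∑ t ∈ Finset.Icc 2 T, ‖u t - u (t - 1)‖

/-- The factor `ln(e + M T² / ε)`. -/
def logFactor (M ε : ℝ) (T : ℕ) : ℝ := Real.log (Real.exp 1 + M * (T : ℝ) ^ 2 / ε)

end KernelOLO

end

/-! Because `⟨g, W φ(t)⟩ = ⟨g ⊗ φ(t), W⟩`, the incurred loss is the loss of a static learner in the
Hilbert–Schmidt space facing `Γ_t = g_t ⊗ φ(t)`. A comparator sequence corresponds to an operator
`U` with `U φ(t) = u_t`. No such `U` is constructed; only the dual form of a bound on its norm is
needed, `|∑ ⟨u_t, g_t⟩| ≤ B ‖∑ Γ_t‖`. The proof thus has two independent halves.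

Static half. After normalisation, `Ψ` is a decreasing scale in `V` times `exp(expo S V) - 1`, the
`S`-derivative of `primitive`. In one round the second-order growth of `primitive` is paid for by
its decrease as `V` grows to `V + ‖Γ_t‖²`, up to an error of order `‖Γ_t‖² / √V` (`primitive_step`).
After scaling, the errors are summable because `v / (V log² V)` telescopes through `1 / log V`.
Hence `∑ ⟨Γ_t, W_t⟩` is at most a constant minus the potential at `‖∑ Γ_t‖`, and adding `B ‖∑ Γ_t‖`
leaves a Fenchel conjugate (`mul_sub_primitive_le`), of order `B (√(V l) + l)` with `l` logarithmic.

Comparator half. `‖∑ Γ_t‖²` is the integral of `Q` against the power spectrum of `g`, while by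
Parseval `∑ ⟨u_t, g_t⟩` is the integral of the cross spectrum over the band `[-1/2, 1/2]`. By
Cauchy–Schwarz, `B²` can be the integral of `1/Q` against the power spectrum of `u` over the band
(`sum_inner_le_of_spectral_bound`). There `1/Q` behaves like `|ω|` times logarithms, and `|ω|` is
dominated by `∑_h h⁻² (2 - 2 cos 2πhω)` away from `0`. The factor `2 - 2 cos 2πhω` produces the
squared increments of `u` at distance `h`, whose sum is at most `2 M h P`; summing over `h` gives `M
P` times a harmonic sum. The lowest frequencies carry weight `O(1/T)` and contribute `O(M²)`.
Together, `B` is of order `log(1+T) log log(1+T) √(M² + M P)` (`exists_comparator_bound`). -/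

namespace KernelOLO

/-! ### The normalised potential -/

section Potential

/-- The maximiser of `e ↦ e * x / 3 - e ^ 2 * V` over `[0, 1]`. -/
noncomputable def rate (x V : ℝ) : ℝ := min (x / (6 * V)) 1

/-- The maximum of `e ↦ e * x / 3 - e ^ 2 * V` over `[0, 1]`. -/
noncomputable def expo (x V : ℝ) : ℝ := if x ≤ 6 * V then x ^ 2 / (36 * V) else x / 3 - V

variable {x y V W v : ℝ}

theorem rate_nonneg (hx : 0 ≤ x) (hV : 0 < V) : 0 ≤ rate x V := le_min (by positivity) zero_le_one

theorem rate_le_one : rate x V ≤ 1 := min_le_right _ _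

theorem expo_eq (hV : 0 < V) : expo x V = rate x V * x / 3 - rate x V ^ 2 * V := by
  unfold expo rate
  split_ifs with h
  · rw [min_eq_left (by rw [div_le_one (by positivity)]; exact h)]
    field_simp
    ring
  · rw [min_eq_right (by rw [one_le_div (by positivity)]; linarith)]
    ring

/-- This variational property yields the later slope bounds: testing it at one point with the
maximiser belonging to another shows that `expo` is convex with slope `rate / 3` in `x` and slope
`-rate ^ 2` in `V`. -/
theorem le_expo (hV : 0 < V) {e : ℝ} (he : e ≤ 1) :
    e * x / 3 - e ^ 2 * V ≤ expo x V := by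
  unfold expo
  split_ifs with h
  · have : x ^ 2 / (36 * V) - (e * x / 3 - e ^ 2 * V) = (x - 6 * e * V) ^ 2 / (36 * V) := by
      field_simp
      ring
    have : 0 ≤ (x - 6 * e * V) ^ 2 / (36 * V) := by positivity
    linarith
  · nlinarith [mul_nonneg (sub_nonneg.2 he) hV.le,
      mul_nonneg (sub_nonneg.2 he) (sub_nonneg.2 (not_le.1 h).le)]

theorem expo_zero (hV : 0 < V) : expo 0 V = 0 := by
  simp [expo, hV.le]

theorem expo_nonneg (hV : 0 < V) : 0 ≤ expo x V := by
  simpa using le_expo (x := x) hV zero_le_one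

theorem expo_sub_ge (hV : 0 < V) : rate x V * (y - x) / 3 ≤ expo y V - expo x V := by
  have := le_expo (x := y) hV (rate_le_one (x := x) (V := V))
  rw [expo_eq (x := x) hV]
  linarith

theorem expo_sub_ge_right (hV : 0 < V) (hW : 0 < W) :
    rate x W ^ 2 * (W - V) ≤ expo x V - expo x W := by
  have := le_expo (x := x) hV (rate_le_one (x := x) (V := W))
  rw [expo_eq (x := x) hW]
  linarith

theorem expo_le_rate_mul (hV : 0 < V) : expo x V ≤ rate x V * x / 3 := by
  rw [expo_eq hV]
  nlinarith [sq_nonneg (rate x V)]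

theorem rate_sq_mul_le_expo (hx : 0 ≤ x) (hV : 0 < V) : rate x V ^ 2 * V ≤ expo x V := by
  have h0 := rate_nonneg hx hV
  have h : rate x V * (6 * V) ≤ x := by
    calc rate x V * (6 * V) ≤ x / (6 * V) * (6 * V) := by gcongr; exact min_le_left _ _
      _ = x := by field_simp
  rw [expo_eq hV]
  nlinarith [mul_le_mul_of_nonneg_left h h0]

theorem expo_mono (hV : 0 < V) (hx : 0 ≤ x) (hxy : x ≤ y) : expo x V ≤ expo y V := by
  have := expo_sub_ge (x := x) (y := y) hV
  have := mul_nonneg (rate_nonneg hx hV) (sub_nonneg.2 hxy)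
  linarith

theorem expo_anti (hV : 0 < V) (hVW : V ≤ W) : expo x W ≤ expo x V := by
  have := expo_sub_ge_right (x := x) hV (hV.trans_le hVW)
  have := mul_nonneg (sq_nonneg (rate x W)) (sub_nonneg.2 hVW)
  linarith

theorem rate_mono (hV : 0 < V) (hxy : x ≤ y) : rate x V ≤ rate y V := by
  exact min_le_min_right _ (by gcongr)

theorem rate_add_one_le (hV : 0 < V) : rate (x + 1) V ≤ rate x V + 1 / (6 * V) := by
  unfold rate
  have : 0 < 1 / (6 * V) := by positivity
  rcases le_total (x / (6 * V)) 1 with h | h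
  · rw [min_eq_left h, add_div]
    exact min_le_left _ _
  · rw [min_eq_right h]
    linarith [min_le_right ((x + 1) / (6 * V)) 1]

theorem mul_rate_le {c : ℝ} (hc1 : c ≤ 1) (hxy : c * x / (6 * V) ≤ y / (6 * W)) (hc0 : 0 ≤ c) :
    c * rate x V ≤ rate y W := by
  unfold rate
  refine le_min ?_ ?_
  · calc c * min (x / (6 * V)) 1 ≤ c * (x / (6 * V)) := by gcongr; exact min_le_left _ _
      _ ≤ _ := by rw [← mul_div_assoc]; exact hxy
  · calc c * min (x / (6 * V)) 1 ≤ c * 1 := by gcongr; exact min_le_right _ _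
      _ ≤ 1 := by rwa [mul_one]

theorem continuous_expo (hV : 0 < V) : Continuous fun x => expo x V := by
  unfold expo
  refine Continuous.if_le (by fun_prop) (by fun_prop) (by fun_prop) (by fun_prop) ?_
  rintro x rfl
  field_simp
  ring

/-! ### The primitive of the potential and its monotonicity. -/

theorem exp_sub_exp_le (a b : ℝ) : Real.exp b - Real.exp a ≤ Real.exp b * (b - a) := by
  have := Real.add_one_le_exp (a - b)
  have h : Real.exp a = Real.exp b * Real.exp (a - b) := by rw [← Real.exp_add]; congr 1; ring
  rw [h]
  nlinarith [Real.exp_pos b]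

/-- The antiderivative of the (unscaled) potential. -/
noncomputable def primitive (S V : ℝ) : ℝ := ∫ x in (0 : ℝ)..S, (Real.exp (expo x V) - 1)

theorem intervalIntegrable_exp_expo (hV : 0 < V) (a b : ℝ) :
    IntervalIntegrable (fun x => Real.exp (expo x V) - 1) volume a b :=
  Continuous.intervalIntegrable
    ((Real.continuous_exp.comp (continuous_expo hV)).sub continuous_const) _ _

theorem primitive_sub (hV : 0 < V) (a b : ℝ) :
    primitive b V - primitive a V = ∫ x in a..b, (Real.exp (expo x V) - 1) :=
  intervalIntegral.integral_interval_sub_left (intervalIntegrable_exp_expo hV _ _)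
    (intervalIntegrable_exp_expo hV _ _)

theorem primitive_zero : primitive 0 V = 0 := intervalIntegral.integral_same

theorem primitive_mono (hV : 0 < V) {a b : ℝ} (hab : a ≤ b) : primitive a V ≤ primitive b V := by
  have := primitive_sub hV a b
  have h : 0 ≤ ∫ x in a..b, (Real.exp (expo x V) - 1) :=
    intervalIntegral.integral_nonneg hab fun x _ => by
      linarith [Real.one_le_exp (expo_nonneg (x := x) hV)]
  linarith

theorem primitive_nonneg (hV : 0 < V) (hx : 0 ≤ x) : 0 ≤ primitive x V := by
  simpa [primitive_zero] using primitive_mono hV hx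

theorem le_primitive_sub (hV : 0 < V) {a b : ℝ} (ha : 0 ≤ a) (hab : a ≤ b) :
    (b - a) * (Real.exp (expo a V) - 1) ≤ primitive b V - primitive a V := by
  rw [primitive_sub hV]
  have := intervalIntegral.integral_mono_on (f := fun _ => Real.exp (expo a V) - 1) hab
    intervalIntegrable_const (intervalIntegrable_exp_expo hV _ _) fun x hx => by
      have := expo_mono hV ha hx.1
      gcongr
  rwa [intervalIntegral.integral_const, smul_eq_mul] at this

theorem primitive_sub_le (hV : 0 < V) {a b : ℝ} (ha : 0 ≤ a) (hb : 0 ≤ b) :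
    primitive b V - primitive a V ≤ (b - a) * (Real.exp (expo b V) - 1) := by
  rcases le_total a b with hab | hab
  · rw [primitive_sub hV]
    have := intervalIntegral.integral_mono_on (g := fun _ => Real.exp (expo b V) - 1) hab
      (intervalIntegrable_exp_expo hV _ _) intervalIntegrable_const fun x hx => by
        have := expo_mono hV (ha.trans hx.1) hx.2
        gcongr
    rwa [intervalIntegral.integral_const, smul_eq_mul] at this
  · have := le_primitive_sub hV hb hab
    linarith

theorem primitive_anti (hV : 0 < V) (hVW : V ≤ W) (hx : 0 ≤ x) :
    primitive x W ≤ primitive x V := by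
  refine intervalIntegral.integral_mono_on hx
    (intervalIntegrable_exp_expo (hV.trans_le hVW) _ _) (intervalIntegrable_exp_expo hV _ _) ?_
  intro z _
  have := expo_anti (x := z) hV hVW
  gcongr

theorem integral_exp_mul_sub {c : ℝ} (hc : c ≠ 0) (a b : ℝ) :
    ∫ x in a..b, Real.exp (c * (x - b)) = (1 - Real.exp (c * (a - b))) / c := by
  have : ∀ x ∈ Set.uIcc a b,
      HasDerivAt (fun x => Real.exp (c * (x - b)) / c) (Real.exp (c * (x - b))) x := by
    intro x _
    have h := ((((hasDerivAt_id x).sub_const b).const_mul c).exp).div_const c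
    simpa [hc] using h
  rw [intervalIntegral.integral_eq_sub_of_hasDerivAt this
    (Continuous.intervalIntegrable (by fun_prop) _ _)]
  simp
  ring

theorem one_sub_exp_neg_ge (hy0 : 0 ≤ y) (hy1 : y ≤ 1) : 63 / 100 * y ≤ 1 - Real.exp (-y) := by
  have h := convexOn_exp.2 (Set.mem_univ 0) (Set.mem_univ (-1)) (sub_nonneg.2 hy1) hy0 (by ring)
  simp only [smul_eq_mul, mul_zero, mul_neg, mul_one, zero_add, Real.exp_zero] at h
  have h1 : Real.exp (-1) ≤ 37 / 100 := by linarith [Real.exp_neg_one_lt_d9]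
  nlinarith

/-- The decrease of the primitive in the second variable. -/
theorem primitive_decrease (hV : 4 ≤ V) (hv0 : 0 ≤ v) (hv1 : v ≤ 1) (hx : 0 ≤ x)
    (hh : 30 ≤ expo x V) :
    9 / 10 * v * Real.exp (expo x V) * rate x V ≤ primitive x V - primitive x (V + v) := by
  have hV0 : 0 < V := by linarith
  have hW0 : 0 < V + v := by linarith
  set η := rate x V with hη
  have hηx : 90 ≤ η * x := by linarith [expo_le_rate_mul (x := x) hV0]
  have hη0 : 0 < η := by
    rcases (rate_nonneg hx hV0).lt_or_eq with h | h
    · exact h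
    · rw [hη, ← h] at hηx
      norm_num at hηx
  -- Only `[9x/10, x]` is used. There the integrand decreases by about `v * rate ^ 2 * exp (expo z
  -- V)`, and integrating `exp (η / 3 * (z - x))` returns a factor `3 / η`, leaving a single power
  -- of `rate`.
  set l := 9 / 10 * x with hl
  have hl0 : 0 ≤ l := by positivity
  have hlx : l ≤ x := by linarith
  have hpt : ∀ z ∈ Set.Icc l x, 63 / 100 * (18 / 25 * η) ^ 2 * v * Real.exp (expo x V) *
      Real.exp (η / 3 * (z - x)) ≤ Real.exp (expo z V) - Real.exp (expo z (V + v)) := by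
    intro z hz
    -- `18/25 = 9/10 * 4/5`: the losses from `z ≥ 9x/10` and from `V + v ≤ 5V/4`.
    have h1 : 18 / 25 * η ≤ rate z (V + v) := by
      refine mul_rate_le (by norm_num) ?_ (by norm_num)
      rw [div_le_div_iff₀ (by positivity) (by positivity)]
      have := hz.1
      have : 18 / 25 * (V + v) * x ≤ V * z := by
        calc 18 / 25 * (V + v) * x ≤ 18 / 25 * (V + V / 4) * x := by gcongr; linarith
          _ = V * l := by rw [hl]; ring
          _ ≤ V * z := by gcongr
      linarith
    have h2 := expo_sub_ge_right (x := z) hV0 hW0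
    have h3 := expo_sub_ge (x := x) (y := z) hV0
    have h4 : (18 / 25 * η) ^ 2 * v ≤ 1 := by
      have : η ≤ 1 := rate_le_one
      have : (18 / 25 * η) ^ 2 ≤ 1 := by
        rw [sq_le_one_iff_abs_le_one, abs_of_nonneg (by positivity)]
        linarith
      nlinarith
    have h5 : expo z (V + v) ≤ expo z V + -((18 / 25 * η) ^ 2 * v) := by
      have : (18 / 25 * η) ^ 2 * v ≤ rate z (V + v) ^ 2 * (V + v - V) := by
        rw [add_sub_cancel_left]
        gcongr
      linarith
    have h6 := one_sub_exp_neg_ge (y := (18 / 25 * η) ^ 2 * v) (by positivity) h4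
    calc 63 / 100 * (18 / 25 * η) ^ 2 * v * Real.exp (expo x V) * Real.exp (η / 3 * (z - x))
        = 63 / 100 * ((18 / 25 * η) ^ 2 * v) * Real.exp (expo x V + η / 3 * (z - x)) := by
          rw [Real.exp_add]; ring
      _ ≤ (1 - Real.exp (-((18 / 25 * η) ^ 2 * v))) * Real.exp (expo z V) := by
          have h7 : 0 ≤ (18 / 25 * η) ^ 2 * v := by positivity
          gcongr
          · linarith
          · linarith
      _ = Real.exp (expo z V) - Real.exp (expo z V + -((18 / 25 * η) ^ 2 * v)) := by
          rw [Real.exp_add]; ring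
      _ ≤ _ := by gcongr
  have hc : Continuous fun z => Real.exp (expo z V) - Real.exp (expo z (V + v)) :=
    (Real.continuous_exp.comp (continuous_expo hV0)).sub
      (Real.continuous_exp.comp (continuous_expo hW0))
  have hI := intervalIntegral.integral_mono_on (μ := volume) hlx
    (Continuous.intervalIntegrable (by fun_prop) _ _) (hc.intervalIntegrable _ _) hpt
  rw [intervalIntegral.integral_const_mul, integral_exp_mul_sub (by positivity)] at hI
  have hsplit : ∫ z in l..x, (Real.exp (expo z V) - Real.exp (expo z (V + v))) =
      (primitive x V - primitive l V) - (primitive x (V + v) - primitive l (V + v)) := by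
    rw [primitive_sub hV0, primitive_sub hW0, ← intervalIntegral.integral_sub
      (intervalIntegrable_exp_expo hV0 _ _) (intervalIntegrable_exp_expo hW0 _ _)]
    congr 1
    ext z
    ring
  have hl1 := primitive_anti (x := l) hV0 (le_add_of_nonneg_right hv0) hl0
  -- Since `η * x ≥ 90`, the interval is long enough for the exponential tail to be negligible.
  have he : Real.exp (η / 3 * (l - x)) ≤ 1 / 20 := by
    have h1 : η / 3 * (l - x) ≤ -3 := by rw [hl]; nlinarith
    have h3 : Real.exp (-3) ≤ 1 / 20 := by
      have : Real.exp (-3) = Real.exp (-1) ^ 3 := by rw [← Real.exp_nat_mul]; norm_num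
      rw [this]
      have := Real.exp_neg_one_lt_d9.le
      calc Real.exp (-1) ^ 3 ≤ 0.3678794412 ^ 3 := by gcongr
        _ ≤ _ := by norm_num
    exact (Real.exp_le_exp.2 h1).trans h3
  have hI2 : 9 / 10 * v * Real.exp (expo x V) * η ≤
      63 / 100 * (18 / 25 * η) ^ 2 * v * Real.exp (expo x V) *
        ((1 - Real.exp (η / 3 * (l - x))) / (η / 3)) := by
    calc 9 / 10 * v * Real.exp (expo x V) * η
        ≤ (63 / 100 * (18 / 25) ^ 2 * 3 * (1 - 1 / 20)) * (v * Real.exp (expo x V) * η) := by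
          have : 0 ≤ v * Real.exp (expo x V) * η := by positivity
          nlinarith
      _ = 63 / 100 * (18 / 25 * η) ^ 2 * v * Real.exp (expo x V) *
        ((1 - 1 / 20) / (η / 3)) := by field_simp
      _ ≤ _ := by gcongr
  linarith

/-! ### One round of the potential argument. -/

theorem exp_expo_sub_le (hV : 0 < V) :
    Real.exp (expo y V) - Real.exp (expo x V) ≤
      Real.exp (expo y V) * (rate y V / 3 * (y - x)) := by
  refine (exp_sub_exp_le _ _).trans ?_
  have := expo_sub_ge (x := y) (y := x) hV
  gcongr
  linarith

/-- This is the second-order remainder of `primitive`. The common upper bound `m` makes it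
independent of whether the norm of the gradient sum grows or shrinks. -/
theorem mul_exp_expo_sub_le (hV : 0 < V) (hx : 0 ≤ x) (hy : 0 ≤ y) {m : ℝ} (hxm : x ≤ m)
    (hym : y ≤ m) :
    (y - x) * (Real.exp (expo y V) - Real.exp (expo x V)) ≤
      (y - x) ^ 2 * (Real.exp (expo m V) * (rate m V / 3)) := by
  wlog h : x ≤ y generalizing x y
  · have := this hy hx hym hxm (le_of_not_ge h)
    linarith
  · have h1 := exp_expo_sub_le (x := x) (y := y) hV
    have h2 := expo_mono hV hy hym
    have h3 := rate_mono hV hym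
    have h4 := rate_nonneg hy hV
    calc (y - x) * (Real.exp (expo y V) - Real.exp (expo x V))
        ≤ (y - x) * (Real.exp (expo y V) * (rate y V / 3 * (y - x))) :=
          mul_le_mul_of_nonneg_left h1 (sub_nonneg.2 h)
      _ = (y - x) ^ 2 * (Real.exp (expo y V) * (rate y V / 3)) := by ring
      _ ≤ _ := by gcongr

/-- The potential decreases up to an error of order `v / √V`. -/
theorem primitive_step {S r p : ℝ} (hV : 4 ≤ V) (hv1 : v ≤ 1) (hS : 0 ≤ S) (hr : 0 ≤ r)
    (hrS : (r - S) ^ 2 ≤ v) (hp : r ^ 2 = S ^ 2 + 2 * p + v) :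
    primitive r (V + v) ≤ primitive S V + (Real.exp (expo S V) - 1) / S * p +
      5 * Real.exp 30 * (v / √V) := by
  have hV0 : 0 < V := by linarith
  have hv0 : 0 ≤ v := (sq_nonneg _).trans hrS
  set q := (Real.exp (expo S V) - 1) / S with hq
  have hq0 : 0 ≤ q := div_nonneg (by linarith [Real.one_le_exp (expo_nonneg (x := S) hV0)]) hS
  have hqS : Real.exp (expo S V) - 1 = q * S := by
    rcases hS.eq_or_lt with h | h
    · rw [← h, expo_zero hV0]; simp
    · rw [hq]; field_simp
  have hq1 : q ≤ Real.exp (expo S V) * (rate S V / 3) := by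
    have h0 := rate_nonneg hS hV0
    rcases hS.eq_or_lt with h | h
    · rw [hq, ← h, div_zero]; rw [← h] at h0; positivity
    · rw [hq, div_le_iff₀ h]
      have := exp_expo_sub_le (x := 0) (y := S) hV0
      rw [expo_zero hV0, Real.exp_zero] at this
      linarith
  have hrS1 : |r - S| ≤ 1 := by
    rw [← sq_le_one_iff_abs_le_one]; linarith
  have hSm : S ≤ r + 1 := by linarith [(abs_le.1 hrS1).1]
  have hη0 := rate_nonneg hr hV0
  have hB0 : 0 ≤ Real.exp (expo (r + 1) V) * (rate (r + 1) V / 3) := by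
    have := rate_nonneg (x := r + 1) (by linarith) hV0
    positivity
  have hSB : Real.exp (expo S V) * (rate S V / 3) ≤
      Real.exp (expo (r + 1) V) * (rate (r + 1) V / 3) := by
    have h1 := expo_mono hV0 hS hSm
    have h2 := rate_mono hV0 hSm
    have h3 := rate_nonneg hS hV0
    gcongr
  -- The factor `1/2` is `1/3 + 1/6`: the remainder of the primitive gives `1/3`, and `S * (r - S) ≤
  -- p + v / 2` gives `1/2` of the slope bound `rate / 3`.
  have h1 : primitive r V ≤ primitive S V + q * p +
      v / 2 * (Real.exp (expo (r + 1) V) * rate (r + 1) V) := by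
    have e1 := primitive_sub_le hV0 hS hr
    have e2 := mul_exp_expo_sub_le hV0 hS hr hSm (le_add_of_nonneg_right zero_le_one)
    have e3 : q * (S * (r - S)) ≤ q * (p + v / 2) := by
      gcongr
      nlinarith [sq_nonneg (r - S)]
    have e4 : q * (v / 2) ≤ Real.exp (expo (r + 1) V) * (rate (r + 1) V / 3) * (v / 2) := by
      have := hq1.trans hSB
      gcongr
    have e5 := mul_le_mul_of_nonneg_right hrS hB0
    have e6 : (r - S) * (Real.exp (expo r V) - 1) = q * (S * (r - S)) +
        (r - S) * (Real.exp (expo r V) - Real.exp (expo S V)) := by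
      linear_combination (r - S) * hqS
    linarith
  have h2 : Real.exp (expo (r + 1) V) * rate (r + 1) V ≤
      7 / 5 * Real.exp (expo r V) * (rate r V + 1 / (6 * V)) := by
    have e1 : expo (r + 1) V ≤ 1 / 3 + expo r V := by
      have := expo_sub_ge (x := r + 1) (y := r) hV0
      have : rate (r + 1) V ≤ 1 := rate_le_one
      linarith
    have e2 : Real.exp (1 / 3) ≤ 7 / 5 := by
      have : Real.exp (1 / 3) ^ 3 ≤ (7 / 5) ^ 3 := by
        rw [← Real.exp_nat_mul]
        have := Real.exp_one_lt_d9
        norm_num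
        linarith
      exact le_of_pow_le_pow_left₀ (by norm_num) (by norm_num) this
    calc Real.exp (expo (r + 1) V) * rate (r + 1) V
        ≤ Real.exp (1 / 3 + expo r V) * (rate r V + 1 / (6 * V)) := by
          have := rate_add_one_le (x := r) hV0
          have := rate_nonneg (x := r + 1) (by linarith) hV0
          gcongr
      _ ≤ _ := by
        rw [Real.exp_add]
        gcongr
  have h3 : primitive r V ≤ primitive S V + q * p +
      7 / 10 * v * Real.exp (expo r V) * (rate r V + 1 / (6 * V)) := by
    have := mul_le_mul_of_nonneg_left h2 (div_nonneg hv0 zero_le_two)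
    linarith
  have hsV : 0 < √V := Real.sqrt_pos.2 hV0
  -- For a large exponent the decrease in `V` covers the whole second-order term. Otherwise `exp
  -- (expo r V)` is bounded and `rate r V ≤ 6 / √V`, so the term goes into the error.
  rcases le_total 30 (expo r V) with hh | hh
  · have e1 := primitive_decrease hV hv0 hv1 hr hh
    have e2 : 1 / (6 * V) ≤ rate r V / 20 := by
      have hr90 : 90 ≤ r := by
        have := expo_le_rate_mul (x := r) hV0
        have := mul_le_mul_of_nonneg_right (rate_le_one (x := r) (V := V)) hr
        linarith
      rw [le_div_iff₀ (by norm_num)]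
      unfold rate
      refine le_min ?_ ?_
      · rw [div_mul_eq_mul_div]
        gcongr
        linarith
      · rw [div_mul_eq_mul_div, div_le_one (by positivity)]
        linarith
    have e3 : 7 / 10 * v * Real.exp (expo r V) * (rate r V + 1 / (6 * V)) ≤
        9 / 10 * v * Real.exp (expo r V) * rate r V := by
      have : 0 ≤ v * Real.exp (expo r V) := by positivity
      have := mul_le_mul_of_nonneg_left e2 this
      have : 0 ≤ v * Real.exp (expo r V) * rate r V := by positivity
      linarith
    have e4 : 0 ≤ 5 * Real.exp 30 * (v / √V) := by positivity
    linarith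
  · have e1 := primitive_anti hV0 (le_add_of_nonneg_right hv0) hr
    have e2 : rate r V ≤ 6 / √V := by
      rw [le_div_iff₀ hsV]
      refine abs_le_of_sq_le_sq' ?_ (by norm_num) |>.2
      rw [mul_pow, Real.sq_sqrt hV0.le]
      linarith [rate_sq_mul_le_expo hr hV0]
    have e3 : 1 / (6 * V) ≤ 1 / √V := by
      have : √V ≤ V := by
        rw [Real.sqrt_le_left hV0.le]
        nlinarith
      gcongr
      linarith
    have e4 : 7 / 10 * v * Real.exp (expo r V) * (rate r V + 1 / (6 * V)) ≤
        7 / 10 * v * Real.exp 30 * (6 / √V + 1 / √V) := by gcongr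
    have e5 : 7 / 10 * v * Real.exp 30 * (6 / √V + 1 / √V) ≤ 5 * Real.exp 30 * (v / √V) := by
      have : 0 ≤ Real.exp 30 * (v / √V) := by positivity
      have : 7 / 10 * v * Real.exp 30 * (6 / √V + 1 / √V) =
        49 / 10 * (Real.exp 30 * (v / √V)) := by field_simp; ring
      linarith
    linarith

/-- A discrete form of `d(-1 / log V) = dV / (V log² V)`. The squared logarithm in the scale of the
potential thus makes the total error independent of the horizon. -/
theorem div_mul_log_sq_le (hV : 4 ≤ V) (hv0 : 0 ≤ v) (hv1 : v ≤ 1) :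
    v / (V * Real.log V ^ 2) ≤ 5 / 2 * (1 / Real.log V - 1 / Real.log (V + v)) := by
  have hV0 : 0 < V := by linarith
  have hl : 0 < Real.log V := Real.log_pos (by linarith)
  have hlW : 0 < Real.log (V + v) := Real.log_pos (by linarith)
  have h1 : Real.log (V + v) ≤ 2 * Real.log V := by
    have : Real.log (V ^ 2) = 2 * Real.log V := by rw [Real.log_pow]; norm_num
    rw [← this]
    exact Real.log_le_log (by linarith) (by nlinarith)
  have h2 : 4 / 5 * (v / V) ≤ Real.log (V + v) - Real.log V := by
    rw [← Real.log_div (by linarith) (by linarith)]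
    have := Real.one_sub_inv_le_log_of_pos (x := (V + v) / V) (by positivity)
    refine le_trans ?_ this
    have e : 1 - ((V + v) / V)⁻¹ = v / (V + v) := by field_simp; ring
    rw [e, ← mul_div_assoc, div_le_div_iff₀ hV0 (by linarith)]
    nlinarith
  have e : 1 / Real.log V - 1 / Real.log (V + v) =
      (Real.log (V + v) - Real.log V) / (Real.log V * Real.log (V + v)) := by field_simp
  rw [e]
  calc v / (V * Real.log V ^ 2) = 5 / 2 * (4 / 5 * (v / V) / (Real.log V * (2 * Real.log V))) := by
        field_simp; norm_num
    _ ≤ _ := by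
      have : 0 ≤ v / V := by positivity
      have : 0 ≤ Real.log (V + v) - Real.log V := by linarith
      gcongr

/-- The scale of the potential. -/
noncomputable def potentialScale (V : ℝ) : ℝ := 1 / (√V * Real.log V ^ 2)

theorem potentialScale_pos (hV : 1 < V) : 0 < potentialScale V := by
  have := Real.log_pos hV
  unfold potentialScale
  positivity

theorem potentialScale_anti (hV : 1 < V) (hVW : V ≤ W) : potentialScale W ≤ potentialScale V := by
  have := Real.log_pos hV
  unfold potentialScale
  gcongr

theorem potential_one_one (S : ℝ) :
    potential 1 1 S V = potentialScale V * (Real.exp (expo S V) - 1) := by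
  unfold potential potentialScale expo
  simp only [mul_one, one_pow, div_one]
  congr 1
  split_ifs <;> rfl

/-- The potential including the compensation for the errors of the remaining rounds. -/
noncomputable def totalPotential (S V : ℝ) : ℝ :=
  potentialScale V * primitive S V + 25 / 2 * Real.exp 30 / Real.log V

theorem totalPotential_step {S r p : ℝ} (hV : 4 ≤ V) (hv1 : v ≤ 1) (hS : 0 ≤ S) (hr : 0 ≤ r)
    (hrS : (r - S) ^ 2 ≤ v) (hp : r ^ 2 = S ^ 2 + 2 * p + v) :
    totalPotential r (V + v) ≤ totalPotential S V + potential 1 1 S V / S * p := by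
  have hv0 : 0 ≤ v := (sq_nonneg _).trans hrS
  have h1 := primitive_step hV hv1 hS hr hrS hp
  have h2 := potentialScale_anti (V := V) (W := V + v) (by linarith) (by linarith)
  have h3 := primitive_nonneg (x := r) (V := V + v) (by linarith) hr
  have h4 := mul_le_mul_of_nonneg_right h2 h3
  have h5 := mul_le_mul_of_nonneg_left h1 (potentialScale_pos (V := V) (by linarith)).le
  have h6 := mul_le_mul_of_nonneg_left (div_mul_log_sq_le hV hv0 hv1)
    (by positivity : 0 ≤ 5 * Real.exp 30)
  have h7 : potentialScale V * (5 * Real.exp 30 * (v / √V)) =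
      5 * Real.exp 30 * (v / (V * Real.log V ^ 2)) := by
    have : √V * √V = V := Real.mul_self_sqrt (by linarith)
    have h0 : 0 < Real.log V := Real.log_pos (by linarith)
    have h0' : 0 < √V := Real.sqrt_pos.2 (by linarith)
    unfold potentialScale
    field_simp
    linear_combination -v * this
  rw [potential_one_one]
  unfold totalPotential
  have h8 : potentialScale V * (Real.exp (expo S V) - 1) / S * p =
    potentialScale V * ((Real.exp (expo S V) - 1) / S * p) := by ring
  rw [h8]
  have h9 : 25 / 2 * Real.exp 30 / Real.log V = 25 / 2 * Real.exp 30 * (1 / Real.log V) := by ring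
  have h10 : 25 / 2 * Real.exp 30 / Real.log (V + v) =
    25 / 2 * Real.exp 30 * (1 / Real.log (V + v)) := by ring
  rw [h9, h10]
  linarith

/-- The Fenchel conjugate of the potential. -/
theorem mul_sub_primitive_le {S b : ℝ} (hV : 4 ≤ V) (hS : 0 ≤ S) (hb : 0 ≤ b) :
    b * S - potentialScale V * primitive S V ≤
      6 * b * (√(V * Real.log (1 + b / potentialScale V)) +
        Real.log (1 + b / potentialScale V)) := by
  have hV0 : 0 < V := by linarith
  have hα : 0 < potentialScale V := potentialScale_pos (by linarith)
  set α := potentialScale V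
  set l := Real.log (1 + b / α) with hl
  have hl0 : 0 ≤ l := Real.log_nonneg (by linarith [div_nonneg hb hα.le])
  set S₀ := 6 * (√(V * l) + l) with hS₀
  have hS₀0 : 0 ≤ S₀ := by positivity
  have key : l ≤ expo S₀ V := by
    rcases le_total l V with h | h
    · have h1 := le_expo (x := S₀) (e := √(l / V)) hV0 (by
        rw [Real.sqrt_le_one, div_le_one hV0]; exact h)
      have h2 : √(l / V) * √(V * l) = l := by
        rw [← Real.sqrt_mul (by positivity)]
        have : l / V * (V * l) = l ^ 2 := by field_simp
        rw [this, Real.sqrt_sq hl0]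
      have h3 : √(l / V) ^ 2 * V = l := by
        rw [Real.sq_sqrt (by positivity)]; field_simp
      have h4 : 0 ≤ √(l / V) * l := by positivity
      rw [h3, hS₀] at h1
      linarith
    · have h1 := le_expo (x := S₀) (e := 1) hV0 le_rfl
      have : 0 ≤ √(V * l) := by positivity
      linarith
  have main : b * S - α * primitive S V ≤ b * S₀ := by
    rcases le_total S S₀ with h | h
    · have := mul_nonneg hα.le (primitive_nonneg hV0 hS)
      have := mul_le_mul_of_nonneg_left h hb
      linarith
    · have h1 := le_primitive_sub hV0 hS₀0 h
      have h2 : b / α ≤ Real.exp (expo S₀ V) - 1 := by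
        have := Real.exp_le_exp.2 key
        rw [hl, Real.exp_log (by linarith [div_nonneg hb hα.le])] at this
        linarith
      have h3 := mul_le_mul_of_nonneg_left h2 (sub_nonneg.2 h)
      have h4 := primitive_nonneg hV0 hS₀0
      have h5 : (S - S₀) * (b / α) ≤ primitive S V := by linarith
      have h6 := mul_le_mul_of_nonneg_left h5 hα.le
      have h7 : α * ((S - S₀) * (b / α)) = b * (S - S₀) := by field_simp
      linarith
  calc _ ≤ b * S₀ := main
    _ = _ := by rw [hS₀]; ring

end Potential

/-! ### The static algorithm -/

section Static

variable {E : Type*} [NormedAddCommGroup E] [InnerProductSpace ℝ E]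

theorem totalPotential_iterate_step (Γ : ℕ → E) (t : ℕ) (h1t : 1 ≤ t) (ht : ‖Γ t‖ ≤ 1) :
    totalPotential ‖∑ s ∈ Finset.Ico 1 (t + 1), Γ s‖
        (4 + ∑ s ∈ Finset.Ico 1 (t + 1), ‖Γ s‖ ^ 2) ≤
      totalPotential ‖∑ s ∈ Finset.Ico 1 t, Γ s‖ (4 + ∑ s ∈ Finset.Ico 1 t, ‖Γ s‖ ^ 2) -
        inner ℝ (Γ t) (staticIterate 1 1 Γ t) := by
  rw [Finset.sum_Ico_succ_top h1t, Finset.sum_Ico_succ_top h1t, ← add_assoc, staticIterate]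
  set Θ := ∑ s ∈ Finset.Ico 1 t, Γ s
  set V := 4 + ∑ s ∈ Finset.Ico 1 t, ‖Γ s‖ ^ 2 with hV
  have hV4 : 4 ≤ V := by
    have : 0 ≤ ∑ s ∈ Finset.Ico 1 t, ‖Γ s‖ ^ 2 := Finset.sum_nonneg fun _ _ => sq_nonneg _
    linarith
  have h := totalPotential_step (V := V) (v := ‖Γ t‖ ^ 2) (S := ‖Θ‖) (r := ‖Θ + Γ t‖)
    (p := inner ℝ Θ (Γ t)) hV4 (by nlinarith [norm_nonneg (Γ t)]) (norm_nonneg _) (norm_nonneg _)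
    (by
      rw [sq_le_sq, abs_of_nonneg (norm_nonneg (Γ t))]
      simpa using abs_norm_sub_norm_le (Θ + Γ t) Θ)
    (norm_add_sq_real Θ (Γ t))
  rw [inner_neg_right, inner_smul_right, real_inner_comm, sub_neg_eq_add, one_pow, mul_one]
  exact h

theorem sum_inner_staticIterate_le (Γ : ℕ → E) (T : ℕ)
    (hΓ : ∀ t ∈ Finset.Icc 1 T, ‖Γ t‖ ≤ 1) :
    ∑ t ∈ Finset.Icc 1 T, inner ℝ (Γ t) (staticIterate 1 1 Γ t) ≤
      25 / 2 * Real.exp 30 - totalPotential ‖∑ s ∈ Finset.Icc 1 T, Γ s‖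
        (4 + ∑ s ∈ Finset.Icc 1 T, ‖Γ s‖ ^ 2) := by
  have hIcc : ∀ n : ℕ, Finset.Icc 1 n = Finset.Ico 1 (n + 1) := fun n => by
    ext; simp
  induction T with
  | zero =>
    have h4 : 1 ≤ Real.log 4 := by
      rw [Real.le_log_iff_exp_le (by norm_num)]
      linarith [Real.exp_one_lt_d9]
    simp [totalPotential, primitive_zero]
    exact div_le_self (by positivity) h4
  | succ n ih =>
    have h1 := ih fun t ht => hΓ t (Finset.Icc_subset_Icc_right n.le_succ ht)
    have h2 := totalPotential_iterate_step Γ (n + 1) (by omega) (hΓ _ (by simp))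
    rw [hIcc n] at h1
    rw [hIcc (n + 1), Finset.sum_Ico_succ_top (by omega)]
    linarith

/-- The static regret of the normalised algorithm, against all comparators of norm `b`. -/
theorem static_regret (Γ : ℕ → E) (T : ℕ) (hΓ : ∀ t ∈ Finset.Icc 1 T, ‖Γ t‖ ≤ 1)
    {b V l : ℝ} (hb : 0 ≤ b) (hV : V = 4 + ∑ s ∈ Finset.Icc 1 T, ‖Γ s‖ ^ 2)
    (hl : l = Real.log (1 + b * (√V * Real.log V ^ 2))) :
    ∑ t ∈ Finset.Icc 1 T, inner ℝ (Γ t) (staticIterate 1 1 Γ t) +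
        b * ‖∑ s ∈ Finset.Icc 1 T, Γ s‖ ≤
      25 / 2 * Real.exp 30 + 6 * b * (√(V * l) + l) := by
  have hV4 : 4 ≤ V := by
    have : 0 ≤ ∑ s ∈ Finset.Icc 1 T, ‖Γ s‖ ^ 2 := Finset.sum_nonneg fun _ _ => sq_nonneg _
    linarith
  have h1 := sum_inner_staticIterate_le Γ T hΓ
  have h2 := mul_sub_primitive_le (b := b) hV4 (norm_nonneg (∑ s ∈ Finset.Icc 1 T, Γ s)) hb
  have h3 : b / potentialScale V = b * (√V * Real.log V ^ 2) := by
    unfold potentialScale; rw [div_div_eq_mul_div, div_one]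
  rw [h3, ← hl] at h2
  rw [← hV] at h1
  have h4 : 0 ≤ 25 / 2 * Real.exp 30 / Real.log V :=
    div_nonneg (by positivity) (Real.log_nonneg (by linarith))
  unfold totalPotential at h1
  linarith

/-- The algorithm is homogeneous in the scale of the losses and of the iterates. -/
theorem staticIterate_eq_smul {L : ℝ} (hL : 0 < L) (ε : ℝ) (Γ : ℕ → E) (t : ℕ) :
    staticIterate ε L Γ t = ε • staticIterate 1 1 (fun s => L⁻¹ • Γ s) t := by
  unfold staticIterate
  rw [← Finset.smul_sum, norm_smul, norm_inv, Real.norm_eq_abs, abs_of_pos hL, smul_neg, smul_smul,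
    smul_smul]
  have h1 : (4 : ℝ) * 1 ^ 2 + ∑ s ∈ Finset.Ico 1 t, ‖L⁻¹ • Γ s‖ ^ 2 =
      (4 * L ^ 2 + ∑ s ∈ Finset.Ico 1 t, ‖Γ s‖ ^ 2) / L ^ 2 := by
    simp only [norm_smul, norm_inv, Real.norm_eq_abs, abs_of_pos hL, mul_pow, ← Finset.mul_sum]
    field_simp
  rw [h1]
  set V := 4 * L ^ 2 + ∑ s ∈ Finset.Ico 1 t, ‖Γ s‖ ^ 2 with hV
  have hV0 : 0 < V := by
    have : 0 ≤ ∑ s ∈ Finset.Ico 1 t, ‖Γ s‖ ^ 2 := Finset.sum_nonneg fun _ _ => sq_nonneg _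
    positivity
  set S := ‖∑ s ∈ Finset.Ico 1 t, Γ s‖
  have h2 : potential ε L S V = ε * potential 1 1 (L⁻¹ * S) (V / L ^ 2) := by
    unfold potential
    have e1 : √(V / L ^ 2) = √V / L := by rw [Real.sqrt_div' _ (by positivity), Real.sqrt_sq hL.le]
    have e2 : S ≤ 6 * V / L ↔ L⁻¹ * S ≤ 6 * (V / L ^ 2) / 1 := by
      rw [div_one, inv_mul_le_iff₀ hL]
      have : L * (6 * (V / L ^ 2)) = 6 * V / L := by field_simp
      rw [this]
    have e3 : (L⁻¹ * S) ^ 2 / (36 * (V / L ^ 2)) = S ^ 2 / (36 * V) := by field_simp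
    have e4 : L⁻¹ * S / (3 * 1) - V / L ^ 2 / 1 ^ 2 = S / (3 * L) - V / L ^ 2 := by field_simp
    rw [e1, e3, e4, one_pow, div_one, ← mul_assoc]
    congr 1
    · rw [div_mul_eq_mul_div, mul_one, one_div_div, mul_div_assoc]
    · simp only [e2]
  rw [h2]
  congr 2
  field_simp

end Static

/-! ### The spectral density -/

section Density

theorem one_lt_log_pi : 1 < Real.log Real.pi := by
  rw [Real.lt_log_iff_exp_lt Real.pi_pos]
  linarith [Real.pi_gt_three, Real.exp_one_lt_d9]

theorem log_log_pi_pos : 0 < Real.log (Real.log Real.pi) := Real.log_pos one_lt_log_pi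

theorem one_lt_log_pi_add {x : ℝ} (hx : 0 ≤ x) : 1 < Real.log (Real.pi + x) :=
  one_lt_log_pi.trans_le (Real.log_le_log Real.pi_pos (by linarith))

theorem log_log_pi_add_pos {x : ℝ} (hx : 0 ≤ x) : 0 < Real.log (Real.log (Real.pi + x)) :=
  Real.log_pos (one_lt_log_pi_add hx)

theorem measurable_spectralDensity : Measurable spectralDensity := by
  unfold spectralDensity
  fun_prop

theorem spectralDensity_neg (ω : ℝ) : spectralDensity (-ω) = spectralDensity ω := by
  simp [spectralDensity]

theorem spectralDensity_pos {ω : ℝ} (hω : ω ≠ 0) : 0 < spectralDensity ω := by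
  have h0 : 0 < |ω| := abs_pos.2 hω
  have h1 : 0 ≤ |ω| ^ (-(1 / 2) : ℝ) := by positivity
  have h2 := one_lt_log_pi_add h1
  have h3 := log_log_pi_add_pos h1
  have h4 := log_log_pi_pos
  unfold spectralDensity
  positivity

theorem hasDerivAt_inv_log_log {ω : ℝ} (hω : 0 < ω) :
    HasDerivAt (fun ω : ℝ => (Real.log (Real.log (Real.pi + ω ^ (-(1 / 2) : ℝ))))⁻¹)
      (1 / (2 * ω * (1 + Real.pi * √ω) * Real.log (Real.pi + ω ^ (-(1 / 2) : ℝ)) *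
        Real.log (Real.log (Real.pi + ω ^ (-(1 / 2) : ℝ))) ^ 2)) ω := by
  have h1 : 0 < ω ^ (-(1 / 2) : ℝ) := by positivity
  have h2 := one_lt_log_pi_add h1.le
  have h3 := log_log_pi_add_pos h1.le
  have hd := ((Real.hasDerivAt_rpow_const (x := ω) (p := -(1 / 2)) (Or.inl hω.ne')).const_add
    Real.pi)
  have h4 : 0 < Real.pi + ω ^ (-(1 / 2) : ℝ) := by positivity
  have hd2 := ((hd.log h4.ne').log (by linarith)).inv h3.ne'
  refine hd2.congr_deriv ?_
  have e1 : ω ^ (-(1 / 2) : ℝ) = (√ω)⁻¹ := by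
    rw [Real.rpow_neg hω.le, Real.sqrt_eq_rpow]
  have e2 : ω ^ (-(1 / 2) - 1 : ℝ) = (√ω)⁻¹ * ω⁻¹ := by
    rw [Real.rpow_sub hω, e1, Real.rpow_one, div_eq_mul_inv]
  rw [e2]
  rw [e1] at h2 h3 h4 ⊢
  have h5 : 0 < √ω := Real.sqrt_pos.2 hω
  have h6 : 0 < Real.log (Real.pi + (√ω)⁻¹) := by linarith
  generalize Real.log (Real.log (Real.pi + (√ω)⁻¹)) = A at *
  generalize Real.log (Real.pi + (√ω)⁻¹) = B at *
  have e3 : Real.pi + (√ω)⁻¹ = (1 + Real.pi * √ω) / √ω := by field_simp; ring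
  have e4 : 0 < 1 + Real.pi * √ω := by positivity
  rw [e3]
  field_simp

theorem tendsto_inv_log_log_zero :
    Filter.Tendsto (fun ω : ℝ => (Real.log (Real.log (Real.pi + ω ^ (-(1 / 2) : ℝ))))⁻¹)
      (nhdsWithin 0 (Set.Ioi 0)) (nhds 0) := by
  have h1 : Filter.Tendsto (fun ω : ℝ => ω ^ (-(1 / 2) : ℝ)) (nhdsWithin 0 (Set.Ioi 0))
      Filter.atTop := tendsto_rpow_neg_nhdsGT_zero (by norm_num)
  exact (Real.tendsto_log_atTop.comp (Real.tendsto_log_atTop.comp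
    (Filter.tendsto_atTop_add_const_left _ Real.pi h1))).inv_tendsto_atTop

theorem tendsto_inv_log_log_atTop :
    Filter.Tendsto (fun ω : ℝ => (Real.log (Real.log (Real.pi + ω ^ (-(1 / 2) : ℝ))))⁻¹)
      Filter.atTop (nhds (Real.log (Real.log (Real.pi + 0)))⁻¹) := by
  have h1 : Filter.Tendsto (fun ω : ℝ => ω ^ (-(1 / 2) : ℝ)) Filter.atTop (nhds 0) :=
    tendsto_rpow_neg_atTop (by norm_num)
  have h2 := one_lt_log_pi_add le_rfl
  have h3 := log_log_pi_add_pos le_rfl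
  exact (((h1.const_add Real.pi).log (by positivity)).log (by linarith)).inv₀ h3.ne'

theorem integrableOn_inv_mul_log :
    IntegrableOn (fun ω : ℝ => 1 / (2 * ω * (1 + Real.pi * √ω) *
      Real.log (Real.pi + ω ^ (-(1 / 2) : ℝ)) *
        Real.log (Real.log (Real.pi + ω ^ (-(1 / 2) : ℝ))) ^ 2)) (Set.Ioi 0) := by
  set F : ℝ → ℝ := fun ω => (Real.log (Real.log (Real.pi + ω ^ (-(1 / 2) : ℝ))))⁻¹ with hF
  -- With the convention `0 ^ (-1/2) = 0`, the value of `F` at `0` is not its right limit `0`, hence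
  -- the update.
  refine integrableOn_Ioi_deriv_of_nonneg (g := Function.update F 0 0) ?_ (fun x hx => ?_)
    (fun x hx => ?_) (l := (Real.log (Real.log (Real.pi + 0)))⁻¹) ?_
  · rw [continuousWithinAt_update_same]
    have : Set.Ici (0 : ℝ) \ {0} = Set.Ioi 0 := Set.Ici_sdiff_left
    rw [this]
    exact tendsto_inv_log_log_zero
  · refine (hasDerivAt_inv_log_log hx).congr_of_eventuallyEq ?_
    filter_upwards [lt_mem_nhds (Set.mem_Ioi.1 hx)] with y hy
    rw [Function.update_of_ne hy.ne']
  · have hx0 : 0 < x := hx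
    have h1 : 0 ≤ x ^ (-(1 / 2) : ℝ) := by positivity
    have h2 := one_lt_log_pi_add h1
    positivity
  · refine tendsto_inv_log_log_atTop.congr' ?_
    filter_upwards [Filter.eventually_gt_atTop 0] with y hy
    rw [Function.update_of_ne hy.ne']

theorem one_add_pi_mul_sqrt_le {ω : ℝ} (hω : 0 ≤ ω) :
    1 + Real.pi * √ω ≤ 200 * (1 + ω ^ 2 / (4 * Real.pi ^ 2)) ^ (1 / 4 : ℝ) := by
  set B := (1 + ω ^ 2 / (4 * Real.pi ^ 2)) ^ (1 / 4 : ℝ) with hB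
  have hp := Real.pi_pos
  have hB1 : 1 ≤ B := Real.one_le_rpow
    (by linarith [show 0 ≤ ω ^ 2 / (4 * Real.pi ^ 2) by positivity]) (by norm_num)
  have h1 : B ^ 4 = 1 + ω ^ 2 / (4 * Real.pi ^ 2) := by
    rw [hB, ← Real.rpow_natCast, ← Real.rpow_mul (by positivity)]
    norm_num
  have h2 : √ω ≤ 3 * B := by
    have : √ω ^ 4 ≤ (3 * B) ^ 4 := by
      have e : √ω ^ 4 = ω ^ 2 := by
        rw [show √ω ^ 4 = (√ω ^ 2) ^ 2 by ring, Real.sq_sqrt hω]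
      rw [e, mul_pow, h1]
      have h3 : ω ^ 2 = 4 * Real.pi ^ 2 * (ω ^ 2 / (4 * Real.pi ^ 2)) := by field_simp
      have h4 : 4 * Real.pi ^ 2 ≤ 81 := by nlinarith [Real.pi_lt_four, Real.pi_lt_d2]
      have h5 : 0 ≤ ω ^ 2 / (4 * Real.pi ^ 2) := by positivity
      nlinarith
    exact le_of_pow_le_pow_left₀ (by norm_num) (by positivity) this
  have h3 : Real.pi * √ω ≤ 4 * (3 * B) := by
    have := Real.pi_lt_four
    gcongr
  linarith

/-- On the positive axis `Q` is at most a constant times the derivative of `1 / log log (π + ω ^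
(-1/2))`, a bounded increasing function. The iterated logarithms make the singularity `1 / |ω|`
integrable. -/
theorem integrable_spectralDensity : Integrable spectralDensity := by
  have hIoi : IntegrableOn spectralDensity (Set.Ioi 0) := by
    refine Integrable.mono' (integrableOn_inv_mul_log.const_mul
      (1 / 4 * Real.log (Real.log Real.pi) * 400))
      measurable_spectralDensity.aestronglyMeasurable ?_
    refine (ae_restrict_iff' measurableSet_Ioi).2 (Filter.Eventually.of_forall fun ω hω => ?_)
    have hω0 : 0 < ω := hω
    rw [Real.norm_of_nonneg (spectralDensity_nonneg ω)]
    unfold spectralDensity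
    rw [abs_of_pos hω0]
    have h1 : 0 ≤ ω ^ (-(1 / 2) : ℝ) := by positivity
    have h2 := one_lt_log_pi_add h1
    have h3 := log_log_pi_add_pos h1
    have h4 := log_log_pi_pos
    have h5 := one_add_pi_mul_sqrt_le hω0.le
    have hp := Real.pi_pos
    generalize Real.log (Real.log (Real.pi + ω ^ (-(1 / 2) : ℝ))) = A at *
    generalize Real.log (Real.pi + ω ^ (-(1 / 2) : ℝ)) = B at *
    have hB : 0 < B := by linarith
    rw [mul_assoc, mul_div_assoc', mul_one, ← mul_assoc,
      div_le_div_iff₀ (by positivity) (by positivity)]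
    have h6 : 0 ≤ 1 / 4 * Real.log (Real.log Real.pi) * (2 * ω * B * A ^ 2) := by positivity
    have := mul_le_mul_of_nonneg_left h5 h6
    linarith
  have hIio : IntegrableOn spectralDensity (Set.Iio 0) := by
    have := IntegrableOn.comp_neg_Iio (c := (0 : ℝ)) (f := spectralDensity) (by simpa using hIoi)
    simpa [spectralDensity_neg] using this
  rw [← integrableOn_univ, ← Set.Iic_union_Ioi (a := (0 : ℝ))]
  exact ((integrableOn_Iic_iff_integrableOn_Iio (by simp)).2 hIio).union hIoi

theorem kernel_zero_pos : 0 < kernel 0 0 := by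
  rw [kernel_eq integrable_spectralDensity]
  simp only [sub_self, mul_zero, Real.cos_zero, mul_one]
  rw [integral_pos_iff_support_of_nonneg spectralDensity_nonneg integrable_spectralDensity]
  have h : Set.Ioi (0 : ℝ) ⊆ Function.support spectralDensity := fun ω hω =>
    (spectralDensity_pos (ne_of_gt hω)).ne'
  refine lt_of_lt_of_le ?_ (measure_mono h)
  simp

/-- The reciprocal of the spectral density on the Nyquist band, up to constants. -/
theorem inv_le_spectralDensity {ω : ℝ} (hω : ω ≠ 0) (h : |ω| ≤ 1 / 2) {x : ℝ}
    (hx : |ω| ^ (-(1 / 2) : ℝ) ≤ x) :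
    1 ≤ spectralDensity ω * (8 / Real.log (Real.log Real.pi) *
      (|ω| * (Real.log (Real.pi + x) * Real.log (Real.log (Real.pi + x)) ^ 2))) := by
  have h0 : 0 < |ω| := abs_pos.2 hω
  have h1 : 0 ≤ |ω| ^ (-(1 / 2) : ℝ) := by positivity
  have h2 := one_lt_log_pi_add h1
  have h3 := log_log_pi_add_pos h1
  have h4 := log_log_pi_pos
  have hp := Real.pi_pos
  have h5 : Real.log (Real.pi + |ω| ^ (-(1 / 2) : ℝ)) ≤ Real.log (Real.pi + x) :=
    Real.log_le_log (by positivity) (by linarith)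
  have h6 : Real.log (Real.log (Real.pi + |ω| ^ (-(1 / 2) : ℝ))) ≤
    Real.log (Real.log (Real.pi + x)) := Real.log_le_log (by linarith) h5
  have h7 : (1 + |ω| ^ 2 / (4 * Real.pi ^ 2)) ^ (1 / 4 : ℝ) ≤ 2 := by
    have e0 : |ω| ^ 2 / (4 * Real.pi ^ 2) ≤ 1 := by
      rw [div_le_one (by positivity)]
      nlinarith [Real.pi_gt_three]
    have e1 : 0 ≤ |ω| ^ 2 / (4 * Real.pi ^ 2) := by positivity
    calc (1 + |ω| ^ 2 / (4 * Real.pi ^ 2)) ^ (1 / 4 : ℝ)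
        ≤ (1 + |ω| ^ 2 / (4 * Real.pi ^ 2)) ^ (1 : ℝ) :=
          Real.rpow_le_rpow_of_exponent_le (by linarith) (by norm_num)
      _ ≤ 2 := by rw [Real.rpow_one]; linarith
  have h8 : 0 < (1 + |ω| ^ 2 / (4 * Real.pi ^ 2)) ^ (1 / 4 : ℝ) := by positivity
  unfold spectralDensity
  generalize (1 + |ω| ^ 2 / (4 * Real.pi ^ 2)) ^ (1 / 4 : ℝ) = D at *
  generalize Real.log (Real.log (Real.pi + |ω| ^ (-(1 / 2) : ℝ))) = A at *
  generalize Real.log (Real.pi + |ω| ^ (-(1 / 2) : ℝ)) = B at *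
  generalize Real.log (Real.log (Real.pi + x)) = A' at *
  generalize Real.log (Real.pi + x) = B' at *
  generalize Real.log (Real.log Real.pi) = c at *
  have hB : 0 < B := by linarith
  have hB' : 0 < B' := by linarith
  rw [div_mul_eq_mul_div, le_div_iff₀ (by positivity), one_mul]
  calc |ω| * D * B * A ^ 2 ≤ |ω| * 2 * B' * A' ^ 2 := by gcongr
    _ = _ := by field_simp; ring

/-! ### Elementary estimates for the logarithmic factors. -/

theorem log_mul_log_log_sq_le {y : ℝ} (hy : 1 < Real.log y) (hy0 : 0 < y) :
    Real.log y * Real.log (Real.log y) ^ 2 ≤ 16 * y := by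
  have key : ∀ z : ℝ, 1 < z → Real.log z ≤ 2 * √z := fun z hz => by
    have h := Real.log_le_self (Real.sqrt_nonneg z)
    rw [Real.log_sqrt (by linarith)] at h
    linarith
  have h1 := key _ hy
  have h2 := key y (by
    by_contra h
    linarith [Real.log_nonpos hy0.le (not_lt.1 h)])
  have h3 : 0 < Real.log (Real.log y) := Real.log_pos hy
  calc Real.log y * Real.log (Real.log y) ^ 2 ≤ Real.log y * (2 * √(Real.log y)) ^ 2 := by gcongr
    _ = 4 * Real.log y ^ 2 := by rw [mul_pow, Real.sq_sqrt (by linarith)]; ring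
    _ ≤ 4 * (2 * √y) ^ 2 := by gcongr
    _ = 16 * y := by rw [mul_pow, Real.sq_sqrt hy0.le]; ring

theorem three_halves_le_log_five : 3 / 2 ≤ Real.log 5 := by
  rw [Real.le_log_iff_exp_le (by norm_num)]
  have : Real.exp (3 / 2) ^ 2 ≤ 5 ^ 2 := by
    rw [← Real.exp_nat_mul]
    have e : Real.exp ((2 : ℕ) * (3 / 2)) = Real.exp 1 ^ 3 := by
      rw [← Real.exp_nat_mul]; norm_num
    rw [e]
    calc Real.exp 1 ^ 3 ≤ 2.7182818286 ^ 3 := by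
          have := Real.exp_one_lt_d9.le
          gcongr
      _ ≤ _ := by norm_num
  exact le_of_pow_le_pow_left₀ (by norm_num) (by norm_num) this

theorem log_mul_log_log_sq_le_of_horizon {T : ℝ} (hT : 4 ≤ T) :
    Real.log (Real.pi + 2 * T) * Real.log (Real.log (Real.pi + 2 * T)) ^ 2 ≤
      18 * (Real.log (1 + T) * Real.log (Real.log (1 + T)) ^ 2) := by
  have hp := Real.pi_pos
  have h1 : 3 / 2 ≤ Real.log (1 + T) := three_halves_le_log_five.trans
    (Real.log_le_log (by norm_num) (by linarith))
  have h2 : Real.log (Real.pi + 2 * T) ≤ 2 * Real.log (1 + T) := by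
    have : Real.log ((1 + T) ^ 2) = 2 * Real.log (1 + T) := by rw [Real.log_pow]; norm_num
    rw [← this]
    exact Real.log_le_log (by linarith) (by nlinarith [Real.pi_lt_four])
  have h3 := one_lt_log_pi_add (x := 2 * T) (by linarith)
  have h4 : Real.log (Real.log (Real.pi + 2 * T)) ≤ 3 * Real.log (Real.log (1 + T)) := by
    have e1 : Real.log (Real.log (Real.pi + 2 * T)) ≤ Real.log (Real.log (1 + T) ^ 3) := by
      refine Real.log_le_log (by linarith) (h2.trans ?_)
      -- This turns `2 * log (1 + T)` into at most `log (1 + T) ^ 3`, so the outer logarithm costs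
      -- only a factor `3`.
      have : 2 ≤ Real.log (1 + T) ^ 2 := by nlinarith
      nlinarith
    rwa [Real.log_pow] at e1
  have h5 : 0 < Real.log (Real.log (Real.pi + 2 * T)) := Real.log_pos h3
  calc _ ≤ 2 * Real.log (1 + T) * (3 * Real.log (Real.log (1 + T))) ^ 2 := by gcongr
    _ = _ := by ring

end Density

/-! ### Trigonometric sums with vector coefficients -/

section Trigonometric

variable {E : Type*} [NormedAddCommGroup E] [InnerProductSpace ℝ E]

/-- The cosine part of the discrete-time Fourier transform of `u` restricted to `s`. -/
noncomputable def cosSum (s : Finset ℕ) (u : ℕ → E) (ω : ℝ) : E :=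
  ∑ n ∈ s, Real.cos (2 * Real.pi * (ω * n)) • u n

/-- The sine part of the discrete-time Fourier transform of `u` restricted to `s`. -/
noncomputable def sinSum (s : Finset ℕ) (u : ℕ → E) (ω : ℝ) : E :=
  ∑ n ∈ s, Real.sin (2 * Real.pi * (ω * n)) • u n

/-- The cross spectrum of two sequences. -/
noncomputable def crossSpectrum (s : Finset ℕ) (u g : ℕ → E) (ω : ℝ) : ℝ :=
  inner ℝ (cosSum s u ω) (cosSum s g ω) + inner ℝ (sinSum s u ω) (sinSum s g ω)

@[fun_prop]
theorem continuous_cosSum (s : Finset ℕ) (u : ℕ → E) : Continuous (cosSum s u) := by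
  unfold cosSum
  fun_prop

@[fun_prop]
theorem continuous_sinSum (s : Finset ℕ) (u : ℕ → E) : Continuous (sinSum s u) := by
  unfold sinSum
  fun_prop

@[fun_prop]
theorem continuous_crossSpectrum (s : Finset ℕ) (u g : ℕ → E) :
    Continuous (crossSpectrum s u g) := by
  unfold crossSpectrum
  fun_prop

theorem crossSpectrum_self (s : Finset ℕ) (u : ℕ → E) (ω : ℝ) :
    crossSpectrum s u u ω = ‖cosSum s u ω‖ ^ 2 + ‖sinSum s u ω‖ ^ 2 := by
  simp [crossSpectrum]

theorem crossSpectrum_self_nonneg (s : Finset ℕ) (u : ℕ → E) (ω : ℝ) :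
    0 ≤ crossSpectrum s u u ω := by
  rw [crossSpectrum_self]
  positivity

theorem crossSpectrum_eq (s : Finset ℕ) (u g : ℕ → E) (ω : ℝ) :
    crossSpectrum s u g ω =
      ∑ n ∈ s, ∑ m ∈ s, Real.cos (2 * Real.pi * (ω * ((n : ℝ) - m))) * inner ℝ (u n) (g m) := by
  simp only [crossSpectrum, cosSum, sinSum, sum_inner, inner_sum, inner_smul_left,
    inner_smul_right, Finset.mul_sum, ← Finset.sum_add_distrib]
  rw [Finset.sum_comm]
  refine Finset.sum_congr rfl fun n _ => Finset.sum_congr rfl fun m _ => ?_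
  rw [show 2 * Real.pi * (ω * ((n : ℝ) - m)) =
    2 * Real.pi * (ω * n) - 2 * Real.pi * (ω * m) by ring, Real.cos_sub]
  simp
  ring

theorem integral_cos_two_pi (k : ℤ) :
    ∫ ω in (-(1 / 2) : ℝ)..(1 / 2), Real.cos (2 * Real.pi * (ω * k)) = if k = 0 then 1 else 0 := by
  split_ifs with h
  · simp [h]
    norm_num
  · have hk : (2 * Real.pi * k : ℝ) ≠ 0 := by
      have : (k : ℝ) ≠ 0 := by exact_mod_cast h
      have := Real.pi_pos
      positivity
    have : ∀ ω : ℝ, 2 * Real.pi * (ω * k) = 2 * Real.pi * k * ω := fun ω => by ring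
    simp only [this]
    rw [intervalIntegral.integral_comp_mul_left (fun x => Real.cos x) hk, integral_cos]
    have e1 : 2 * Real.pi * k * (1 / 2) = k * Real.pi := by ring
    have e2 : 2 * Real.pi * k * -(1 / 2) = -(k * Real.pi) := by ring
    rw [e1, e2, Real.sin_neg, Real.sin_int_mul_pi]
    simp

/-- Parseval: integer frequencies are orthogonal on a band of length one. -/
theorem integral_crossSpectrum (s : Finset ℕ) (u g : ℕ → E) :
    ∫ ω in (-(1 / 2) : ℝ)..(1 / 2), crossSpectrum s u g ω = ∑ n ∈ s, inner ℝ (u n) (g n) := by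
  simp only [crossSpectrum_eq]
  rw [intervalIntegral.integral_finsetSum fun n _ =>
    Continuous.intervalIntegrable (by fun_prop) _ _]
  refine Finset.sum_congr rfl fun n hn => ?_
  rw [intervalIntegral.integral_finsetSum fun n _ =>
    Continuous.intervalIntegrable (by fun_prop) _ _]
  simp only [intervalIntegral.integral_mul_const]
  have h : ∀ m : ℕ, ∫ ω in (-(1 / 2) : ℝ)..(1 / 2),
      Real.cos (2 * Real.pi * (ω * ((n : ℝ) - m))) = if n = m then 1 else 0 := fun m => by
    have := integral_cos_two_pi ((n : ℤ) - m)
    push_cast at this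
    rw [this]
    simp only [sub_eq_zero, Nat.cast_inj]
  simp only [h]
  simp [hn]

/-- The condition `f 0 = 0` makes truncated subtraction act as a shift of the zero extension. -/
theorem sum_range_shift {F : Type*} [AddCommGroup F] [Module ℝ F] {f : ℕ → F} (h0 : f 0 = 0)
    (c : ℕ → ℝ) (h K : ℕ) :
    ∑ n ∈ Finset.range (h + K), c n • f (n - h) = ∑ n ∈ Finset.range K, c (h + n) • f n := by
  rw [Finset.sum_range_add]
  have : ∑ n ∈ Finset.range h, c n • f (n - h) = 0 := Finset.sum_eq_zero fun n hn => by
    rw [Nat.sub_eq_zero_of_le (Finset.mem_range.1 hn).le, h0, smul_zero]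
  rw [this, zero_add]
  simp

theorem sum_range_extend {F : Type*} [AddCommGroup F] {f : ℕ → F} {K : ℕ}
    (hf : ∀ n, K ≤ n → f n = 0) (h : ℕ) :
    ∑ n ∈ Finset.range (h + K), f n = ∑ n ∈ Finset.range K, f n := by
  rw [add_comm, Finset.sum_range_add, Finset.sum_eq_zero (s := Finset.range h), add_zero]
  exact fun n _ => hf _ (by omega)

/-- The spectrum of the increments at distance `h`. -/
theorem crossSpectrum_increment {f : ℕ → E} (h0 : f 0 = 0) {K : ℕ} (hf : ∀ n, K ≤ n → f n = 0)
    (h : ℕ) (ω : ℝ) :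
    (2 - 2 * Real.cos (2 * Real.pi * (ω * h))) * crossSpectrum (Finset.range K) f f ω =
      crossSpectrum (Finset.range (h + K)) (fun n => f (n - h) - f n)
        (fun n => f (n - h) - f n) ω := by
  rw [crossSpectrum_self, crossSpectrum_self]
  have harg : ∀ n : ℕ, 2 * Real.pi * (ω * (h + n : ℕ)) =
      2 * Real.pi * (ω * h) + 2 * Real.pi * (ω * n) := fun n => by push_cast; ring
  set θ := 2 * Real.pi * (ω * h) with hθ
  -- The shift multiplies the transform by `e^{iθ}`. `hC` and `hS` are the two components of
  -- multiplication by `e^{iθ} - 1`, whose squared modulus is `2 - 2 cos θ`.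
  have hC : cosSum (Finset.range (h + K)) (fun n => f (n - h) - f n) ω =
      (Real.cos θ - 1) • cosSum (Finset.range K) f ω -
        Real.sin θ • sinSum (Finset.range K) f ω := by
    simp only [cosSum, sinSum, smul_sub, Finset.sum_sub_distrib]
    rw [sum_range_shift h0 (fun n => Real.cos (2 * Real.pi * (ω * n))),
      sum_range_extend (f := fun n : ℕ => Real.cos (2 * Real.pi * (ω * n)) • f n)
        fun n hn => by rw [hf n hn, smul_zero]]
    simp only [harg, Real.cos_add, sub_smul, Finset.smul_sum, smul_smul, sub_mul, one_mul,
      Finset.sum_sub_distrib]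
    abel
  have hS : sinSum (Finset.range (h + K)) (fun n => f (n - h) - f n) ω =
      Real.sin θ • cosSum (Finset.range K) f ω +
        (Real.cos θ - 1) • sinSum (Finset.range K) f ω := by
    simp only [cosSum, sinSum, smul_sub, Finset.sum_sub_distrib]
    rw [sum_range_shift h0 (fun n => Real.sin (2 * Real.pi * (ω * n))),
      sum_range_extend (f := fun n : ℕ => Real.sin (2 * Real.pi * (ω * n)) • f n)
        fun n hn => by rw [hf n hn, smul_zero]]
    simp only [harg, Real.sin_add, sub_smul, add_smul, Finset.smul_sum, smul_smul, sub_mul,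
      one_mul, Finset.sum_add_distrib, Finset.sum_sub_distrib]
    abel
  rw [hC, hS, norm_sub_sq_real, norm_add_sq_real]
  simp only [norm_smul, mul_pow, inner_smul_left, inner_smul_right, Real.norm_eq_abs, sq_abs]
  have := Real.sin_sq_add_cos_sq θ
  simp only [conj_trivial]
  linear_combination (‖cosSum (Finset.range K) f ω‖ ^ 2 + ‖sinSum (Finset.range K) f ω‖ ^ 2) *
    (-this)

theorem sum_norm_increment_le {F : Type*} [NormedAddCommGroup F] {f : ℕ → F} (h K : ℕ) :
    ∑ n ∈ Finset.range K, ‖f (n - h) - f n‖ ≤ h * ∑ n ∈ Finset.range K, ‖f (n - 1) - f n‖ := by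
  induction h with
  | zero => simp
  | succ h ih =>
    have h1 : ∑ n ∈ Finset.range K, ‖f (n - (h + 1)) - f (n - h)‖ ≤
        ∑ n ∈ Finset.range K, ‖f (n - 1) - f n‖ := by
      have hs := sum_range_shift (f := fun n => ‖f (n - 1) - f n‖) (by simp) (fun _ => 1) h K
      simp only [one_smul] at hs
      rw [← hs]
      refine (Finset.sum_le_sum_of_subset_of_nonneg (Finset.range_mono (Nat.le_add_left K h))
        fun _ _ _ => norm_nonneg _).trans (le_of_eq ?_)
      rfl
    have h2 : ∑ n ∈ Finset.range K, ‖f (n - (h + 1)) - f n‖ ≤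
        ∑ n ∈ Finset.range K, ‖f (n - (h + 1)) - f (n - h)‖ +
          ∑ n ∈ Finset.range K, ‖f (n - h) - f n‖ := by
      rw [← Finset.sum_add_distrib]
      exact Finset.sum_le_sum fun n _ => norm_sub_le_norm_sub_add_norm_sub _ _ _
    push_cast
    linarith

/-- One factor of each squared increment is bounded by `2 * M`; the other telescopes into `h` unit
steps. The bound is therefore linear in the path length and in `h`. -/
theorem integral_increment_le {f : ℕ → E} (h0 : f 0 = 0) {K : ℕ} (hf : ∀ n, K ≤ n → f n = 0)
    {M P : ℝ} (hM : ∀ n, ‖f n‖ ≤ M) {h : ℕ}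
    (hP : ∑ n ∈ Finset.range (h + K), ‖f (n - 1) - f n‖ ≤ P) :
    ∫ ω in (-(1 / 2) : ℝ)..(1 / 2), (2 - 2 * Real.cos (2 * Real.pi * (ω * h))) *
      crossSpectrum (Finset.range K) f f ω ≤ 2 * M * (h * P) := by
  simp only [crossSpectrum_increment h0 hf]
  rw [integral_crossSpectrum]
  have hM0 : 0 ≤ M := (norm_nonneg _).trans (hM 0)
  calc ∑ n ∈ Finset.range (h + K), inner ℝ (f (n - h) - f n) (f (n - h) - f n)
      ≤ ∑ n ∈ Finset.range (h + K), 2 * M * ‖f (n - h) - f n‖ := by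
        refine Finset.sum_le_sum fun n _ => ?_
        rw [real_inner_self_eq_norm_sq, sq]
        gcongr
        linarith [norm_sub_le (f (n - h)) (f n), hM (n - h), hM n]
    _ = 2 * M * ∑ n ∈ Finset.range (h + K), ‖f (n - h) - f n‖ := by rw [Finset.mul_sum]
    _ ≤ 2 * M * (h * P) := by
        have := sum_norm_increment_le (f := f) h (h + K)
        gcongr
        exact this.trans (by gcongr)

end Trigonometric

/-! ### Duality in the reproducing kernel Hilbert space -/

section Duality

variable {d : ℕ}

theorem inner_tensorFeature (g g' : EuclideanSpace ℝ (Fin d)) (s t : ℝ) :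
    inner ℝ (tensorFeature g s) (tensorFeature g' t) = inner ℝ g g' * kernel s t := by
  simp only [tensorFeature, PiLp.inner_apply, inner_smul_left, inner_smul_right, inner_feature,
    Finset.sum_mul]
  refine Finset.sum_congr rfl fun i _ => ?_
  simp
  ring

theorem norm_tensorFeature_sq (g : EuclideanSpace ℝ (Fin d)) (t : ℝ) :
    ‖tensorFeature g t‖ ^ 2 = ‖g‖ ^ 2 * kernel 0 0 := by
  rw [← real_inner_self_eq_norm_sq, inner_tensorFeature, kernel_diag, real_inner_self_eq_norm_sq]

theorem inner_tensorFeature_right (g : EuclideanSpace ℝ (Fin d)) (W : OpSpace d) (t : ℝ) :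
    inner ℝ (tensorFeature g t) W = inner ℝ g (evalOp W t) := by
  simp only [tensorFeature, evalOp, PiLp.inner_apply, inner_smul_left]
  refine Finset.sum_congr rfl fun i _ => ?_
  rw [real_inner_comm]
  simp [mul_comm]

theorem integrable_spectralDensity_mul_crossSpectrum (s : Finset ℕ)
    (g : ℕ → EuclideanSpace ℝ (Fin d)) :
    Integrable fun ω => spectralDensity ω * crossSpectrum s g g ω := by
  simp only [crossSpectrum_eq, Finset.mul_sum]
  refine integrable_finsetSum _ fun n _ => integrable_finsetSum _ fun m _ => ?_
  simp only [← mul_assoc]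
  refine Integrable.mul_const ?_ _
  refine integrable_spectralDensity.mul_bdd (c := 1) (by fun_prop)
    (Filter.Eventually.of_forall fun ω => ?_)
  rw [Real.norm_eq_abs]
  exact Real.abs_cos_le_one _

theorem norm_sum_tensorFeature_sq (s : Finset ℕ) (g : ℕ → EuclideanSpace ℝ (Fin d)) :
    ‖∑ t ∈ s, tensorFeature (g t) t‖ ^ 2 = ∫ ω, spectralDensity ω * crossSpectrum s g g ω := by
  have hi (n m : ℕ) : Integrable fun ω => spectralDensity ω *
      (Real.cos (2 * Real.pi * (ω * ((n : ℝ) - m))) * inner ℝ (g n) (g m)) := by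
    simp only [← mul_assoc]
    refine Integrable.mul_const ?_ _
    refine integrable_spectralDensity.mul_bdd (c := 1) (by fun_prop)
      (Filter.Eventually.of_forall fun ω => ?_)
    rw [Real.norm_eq_abs]
    exact Real.abs_cos_le_one _
  simp only [crossSpectrum_eq, Finset.mul_sum]
  rw [integral_finsetSum _ fun n _ => integrable_finsetSum _ fun m _ => hi n m,
    ← real_inner_self_eq_norm_sq, sum_inner]
  refine Finset.sum_congr rfl fun n _ => ?_
  rw [integral_finsetSum _ fun m _ => hi n m, inner_sum]
  refine Finset.sum_congr rfl fun m _ => ?_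
  rw [inner_tensorFeature, kernel_eq integrable_spectralDensity, mul_comm, ← integral_mul_const]
  congr 1
  ext ω
  ring

/-- If `1 / Q ≤ R` on the Nyquist band, then the squared minimal norm of an interpolant of `u` is
at most the integral of `R` against the power spectrum of `u`. -/
theorem sum_inner_le_of_spectral_bound (s : Finset ℕ) (u g : ℕ → EuclideanSpace ℝ (Fin d))
    {R : ℝ → ℝ} (hRc : Continuous R)
    (hR : ∀ ω, ω ≠ 0 → |ω| ≤ 1 / 2 → 1 ≤ spectralDensity ω * R ω) {B : ℝ} (hB : 0 ≤ B)
    (hRB : ∫ ω in (-(1 / 2) : ℝ)..(1 / 2), R ω * crossSpectrum s u u ω ≤ B ^ 2) :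
    |∑ t ∈ s, inner ℝ (u t) (g t)| ≤ B * ‖∑ t ∈ s, tensorFeature (g t) t‖ := by
  set N := ‖∑ t ∈ s, tensorFeature (g t) t‖ with hN
  set X := ∑ t ∈ s, inner ℝ (u t) (g t) with hX
  have hQi := integrable_spectralDensity_mul_crossSpectrum s g
  -- Frequencies outside the band are discarded; their contribution to the norm is nonnegative.
  have hQN : ∫ ω in (-(1 / 2) : ℝ)..(1 / 2), spectralDensity ω * crossSpectrum s g g ω ≤ N ^ 2 := by
    rw [hN, norm_sum_tensorFeature_sq, intervalIntegral.integral_of_le (by norm_num)]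
    exact setIntegral_le_integral hQi (Filter.Eventually.of_forall fun ω =>
      mul_nonneg (spectralDensity_nonneg ω) (crossSpectrum_self_nonneg _ _ _))
  -- Cauchy–Schwarz by discriminant: integrate `Q |ĝ - (x / Q) û|² ≥ 0` over the band, after
  -- replacing `1 / Q` by `R`.
  have key : ∀ x : ℝ, 0 ≤ B ^ 2 * (x * x) + (-2 * X) * x + N ^ 2 := by
    intro x
    have hI1 : IntervalIntegrable (fun ω => R ω * crossSpectrum s u u ω) volume
      (-(1 / 2)) (1 / 2) := Continuous.intervalIntegrable (by fun_prop) _ _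
    have hI2 : IntervalIntegrable (fun ω => crossSpectrum s u g ω) volume
      (-(1 / 2)) (1 / 2) := Continuous.intervalIntegrable (by fun_prop) _ _
    have hI3 : IntervalIntegrable (fun ω => spectralDensity ω * crossSpectrum s g g ω) volume
      (-(1 / 2)) (1 / 2) := hQi.intervalIntegrable
    have hI : 0 ≤ ∫ ω in (-(1 / 2) : ℝ)..(1 / 2), (R ω * crossSpectrum s u u ω * (x * x) +
        crossSpectrum s u g ω * (-2 * x) + spectralDensity ω * crossSpectrum s g g ω) := by
      rw [intervalIntegral.integral_of_le (by norm_num)]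
      refine integral_nonneg_of_ae ?_
      have h0 : ∀ᵐ ω ∂(volume.restrict (Set.Ioc (-(1 / 2) : ℝ) (1 / 2))), ω ≠ 0 :=
        ae_restrict_of_ae (Measure.ae_ne volume 0)
      filter_upwards [h0, ae_restrict_mem measurableSet_Ioc] with ω hω hm
      have hR1 := hR ω hω (abs_le.2 ⟨hm.1.le, hm.2⟩)
      have hQ := spectralDensity_pos hω
      set q := spectralDensity ω
      have h1 : q⁻¹ ≤ R ω := by rwa [inv_le_iff_one_le_mul₀' hQ]
      have h2 := mul_le_mul_of_nonneg_right h1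
        (mul_nonneg (crossSpectrum_self_nonneg s u ω) (mul_self_nonneg x))
      have h3 : 0 ≤ q * (‖cosSum s g ω - (x * q⁻¹) • cosSum s u ω‖ ^ 2 +
          ‖sinSum s g ω - (x * q⁻¹) • sinSum s u ω‖ ^ 2) := by positivity
      have h4 : q * (‖cosSum s g ω - (x * q⁻¹) • cosSum s u ω‖ ^ 2 +
          ‖sinSum s g ω - (x * q⁻¹) • sinSum s u ω‖ ^ 2) =
          q * crossSpectrum s g g ω - 2 * x * crossSpectrum s u g ω +
            q⁻¹ * (crossSpectrum s u u ω * (x * x)) := by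
        rw [norm_sub_sq_real, norm_sub_sq_real, crossSpectrum_self, crossSpectrum_self,
          crossSpectrum]
        simp only [norm_smul, mul_pow, inner_smul_right, Real.norm_eq_abs, sq_abs]
        rw [real_inner_comm, real_inner_comm (sinSum s u ω)]
        field_simp
        ring
      simp only [Pi.zero_apply]
      linarith
    rw [intervalIntegral.integral_add ((hI1.mul_const _).add (hI2.mul_const _)) hI3,
      intervalIntegral.integral_add (hI1.mul_const _) (hI2.mul_const _),
      intervalIntegral.integral_mul_const, intervalIntegral.integral_mul_const,
      integral_crossSpectrum, ← hX] at hI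
    have := mul_le_mul_of_nonneg_right hRB (mul_self_nonneg x)
    linarith
  have hd := discrim_le_zero key
  unfold discrim at hd
  refine abs_le_of_sq_le_sq ?_ (by positivity)
  rw [mul_pow]
  linarith

end Duality

/-! ### The spectral weight -/

section Weight

/-- The growth factor `log(1 + T) (log log(1 + T))²` of the reciprocal spectral density. -/
noncomputable def logGrowth (T : ℝ) : ℝ := Real.log (1 + T) * Real.log (Real.log (1 + T)) ^ 2

/-- A trigonometric polynomial that dominates the reciprocal spectral density on the Nyquist
band. -/
noncomputable def bandWeight (T : ℕ) (ω : ℝ) : ℝ :=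
  8 / Real.log (Real.log Real.pi) * (32 / T + 18 * logGrowth T * (1 / 4 *
    ∑ h ∈ Finset.range (T ^ 2), (((h + 1 : ℕ) : ℝ) ^ 2)⁻¹ *
      (2 - 2 * Real.cos (2 * Real.pi * (ω * (h + 1 : ℕ))))))

@[fun_prop]
theorem continuous_bandWeight (T : ℕ) : Continuous (bandWeight T) := by
  unfold bandWeight
  fun_prop

theorem logGrowth_nonneg {T : ℝ} (hT : 4 ≤ T) : 0 ≤ logGrowth T :=
  mul_nonneg (Real.log_nonneg (by linarith)) (sq_nonneg _)

theorem two_sub_two_cos_nonneg (x : ℝ) : 0 ≤ 2 - 2 * Real.cos x := by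
  linarith [Real.cos_le_one x]

theorem le_two_sub_two_cos {ω : ℝ} {h : ℕ} (hωh : |ω| * h ≤ 1 / 2) :
    16 * (|ω| ^ 2 * (h : ℝ) ^ 2) ≤ 2 - 2 * Real.cos (2 * Real.pi * (ω * h)) := by
  have hp := Real.pi_pos
  have e : 2 * Real.pi * (ω * h) = 2 * (Real.pi * (ω * h)) := by ring
  have habs : |Real.pi * (ω * h)| = Real.pi * (|ω| * h) := by
    rw [abs_mul, abs_mul, abs_of_pos hp, Nat.abs_cast]
  have h1 := Real.mul_abs_le_abs_sin (x := Real.pi * (ω * h)) (by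
    rw [habs]; nlinarith)
  rw [habs] at h1
  have h2 : 2 / Real.pi * (Real.pi * (|ω| * h)) = 2 * (|ω| * h) := by field_simp
  rw [h2] at h1
  have h3 : (2 * (|ω| * h)) ^ 2 ≤ |Real.sin (Real.pi * (ω * h))| ^ 2 := by gcongr
  rw [sq_abs] at h3
  rw [e, Real.cos_two_mul, Real.cos_sq']
  nlinarith

/-- For `h ≤ 1 / (2|ω|)` Jordan's inequality makes each term at least `16 ω²`, and there are at
least `1 / (4|ω|)` such `h`. The lower bound on `|ω|` ensures that all of them occur in the sum. -/
theorem abs_le_sum_two_sub_two_cos {ω : ℝ} {N : ℕ} (hN0 : 0 < N) (h0 : ω ≠ 0)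
    (h : |ω| ≤ 1 / 2) (hN : 1 / (2 * N) ≤ |ω|) :
    |ω| ≤ 1 / 4 * ∑ h ∈ Finset.range N, (((h + 1 : ℕ) : ℝ) ^ 2)⁻¹ *
      (2 - 2 * Real.cos (2 * Real.pi * (ω * (h + 1 : ℕ)))) := by
  have hω : 0 < |ω| := abs_pos.2 h0
  set m := ⌊1 / (2 * |ω|)⌋₊ with hm
  have hy : 1 ≤ 1 / (2 * |ω|) := by rw [le_div_iff₀ (by positivity)]; linarith
  have hm1 : (m : ℝ) ≤ 1 / (2 * |ω|) := Nat.floor_le (by positivity)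
  have hm2 : 1 / (4 * |ω|) ≤ m := by
    have h1 : 1 / (2 * |ω|) < m + 1 := Nat.lt_floor_add_one _
    have h2 : 1 ≤ m := by
      rw [hm, Nat.one_le_floor_iff]; exact hy
    have h3 : (1 : ℝ) ≤ m := by exact_mod_cast h2
    have h4 : 1 / (4 * |ω|) = 1 / 2 * (1 / (2 * |ω|)) := by field_simp; norm_num
    rw [h4]
    linarith
  have hmN : m ≤ N := by
    have hN0' : (0 : ℝ) < N := by exact_mod_cast hN0
    have : (m : ℝ) ≤ N := hm1.trans (by
      rw [div_le_iff₀ (by positivity)] at hN ⊢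
      linarith)
    exact_mod_cast this
  calc |ω| ≤ 1 / 4 * ∑ h ∈ Finset.range m, 16 * |ω| ^ 2 := by
        rw [Finset.sum_const, Finset.card_range, nsmul_eq_mul]
        rw [div_le_iff₀ (by positivity)] at hm2
        nlinarith
    _ ≤ 1 / 4 * ∑ h ∈ Finset.range m, (((h + 1 : ℕ) : ℝ) ^ 2)⁻¹ *
      (2 - 2 * Real.cos (2 * Real.pi * (ω * (h + 1 : ℕ)))) := by
        refine mul_le_mul_of_nonneg_left (Finset.sum_le_sum fun i hi => ?_) (by norm_num)
        have hi1 : ((i + 1 : ℕ) : ℝ) ≤ m := by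
          exact_mod_cast Finset.mem_range.1 hi
        have hle : |ω| * (i + 1 : ℕ) ≤ 1 / 2 := by
          have := mul_le_mul_of_nonneg_left (hi1.trans hm1) hω.le
          have e : |ω| * (1 / (2 * |ω|)) = 1 / 2 := by field_simp
          linarith
        have := le_two_sub_two_cos hle
        have hpos : (0 : ℝ) < (i + 1 : ℕ) := by positivity
        rw [inv_mul_eq_div, le_div_iff₀ (by positivity)]
        linarith
    _ ≤ _ := by
        gcongr
        exact fun _ _ _ => mul_nonneg (by positivity) (two_sub_two_cos_nonneg _)

theorem one_le_spectralDensity_mul_bandWeight {T : ℕ} (hT : 4 ≤ T) {ω : ℝ} (h0 : ω ≠ 0)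
    (h : |ω| ≤ 1 / 2) : 1 ≤ spectralDensity ω * bandWeight T ω := by
  have hω : 0 < |ω| := abs_pos.2 h0
  have hT' : (4 : ℝ) ≤ T := by exact_mod_cast hT
  have hT0 : (0 : ℝ) < T := by linarith
  have hL := logGrowth_nonneg hT'
  have hQ := spectralDensity_nonneg ω
  have hc := log_log_pi_pos
  have hx : |ω| ^ (-(1 / 2) : ℝ) = (√|ω|)⁻¹ := by rw [Real.rpow_neg hω.le, Real.sqrt_eq_rpow]
  have hsω : 0 < √|ω| := Real.sqrt_pos.2 hω
  have hsum : 0 ≤ ∑ h ∈ Finset.range (T ^ 2), (((h + 1 : ℕ) : ℝ) ^ 2)⁻¹ *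
      (2 - 2 * Real.cos (2 * Real.pi * (ω * (h + 1 : ℕ)))) :=
    Finset.sum_nonneg fun _ _ => mul_nonneg (by positivity) (two_sub_two_cos_nonneg _)
  -- Above the cutoff `|ω| ^ (-1/2) ≤ 2T`, so the logarithms are those of the horizon. Below it
  -- `√|ω| ≤ 1 / T`, and the constant term `32 / T` of the weight suffices.
  rcases le_total (1 / (2 * ((T ^ 2 : ℕ) : ℝ))) |ω| with hh | hh
  · refine (inv_le_spectralDensity (x := 2 * T) h0 h ?_).trans ?_
    · rw [hx, inv_le_comm₀ hsω (by positivity)]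
      apply Real.le_sqrt_of_sq_le
      refine le_trans ?_ hh
      push_cast
      rw [inv_pow, mul_pow, ← one_div]
      gcongr
      norm_num
    · have h1 := abs_le_sum_two_sub_two_cos (by positivity) h0 h hh
      have h2 := log_mul_log_log_sq_le_of_horizon hT'
      have h3 : 0 ≤ Real.log (Real.pi + 2 * T) * Real.log (Real.log (Real.pi + 2 * T)) ^ 2 :=
        mul_nonneg (by linarith [one_lt_log_pi_add (x := 2 * T) (by positivity)]) (sq_nonneg _)
      unfold bandWeight
      have h4 : |ω| * (Real.log (Real.pi + 2 * T) *
          Real.log (Real.log (Real.pi + 2 * T)) ^ 2) ≤ (1 / 4 *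
          ∑ h ∈ Finset.range (T ^ 2), (((h + 1 : ℕ) : ℝ) ^ 2)⁻¹ *
            (2 - 2 * Real.cos (2 * Real.pi * (ω * (h + 1 : ℕ))))) * (18 * logGrowth T) :=
        mul_le_mul h1 h2 h3 (by positivity)
      gcongr
      have : (0 : ℝ) ≤ 32 / T := by positivity
      linarith
  · refine (inv_le_spectralDensity h0 h le_rfl).trans ?_
    have hx0 : 0 ≤ |ω| ^ (-(1 / 2) : ℝ) := by positivity
    have h1 := log_mul_log_log_sq_le (one_lt_log_pi_add hx0)
      (by linarith [Real.pi_pos])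
    unfold bandWeight
    have h2 : |ω| * (16 * (Real.pi + |ω| ^ (-(1 / 2) : ℝ))) ≤ 32 / T := by
      have e1 : |ω| * (√|ω|)⁻¹ = √|ω| := by
        have := Real.mul_self_sqrt hω.le
        field_simp
        linarith
      have e2 : √|ω| ≤ 1 / T := by
        rw [Real.sqrt_le_left (by positivity)]
        refine hh.trans ?_
        push_cast
        rw [div_pow, one_pow]
        gcongr
        nlinarith
      have e3 : |ω| * Real.pi ≤ 1 / T := by
        calc |ω| * Real.pi ≤ 1 / (2 * ((T ^ 2 : ℕ) : ℝ)) * 4 := by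
              have := Real.pi_lt_four.le
              have := Real.pi_pos
              gcongr
          _ ≤ 1 / T := by
              push_cast
              rw [div_mul_eq_mul_div, div_le_div_iff₀ (by positivity) hT0]
              nlinarith
      have e4 : (32 : ℝ) / T = 16 * (1 / T + 1 / T) := by ring
      rw [hx, e4]
      linarith
    have h3 := mul_le_mul_of_nonneg_left h1 hω.le
    gcongr
    have : 0 ≤ 18 * logGrowth T * (1 / 4 *
      ∑ h ∈ Finset.range (T ^ 2), (((h + 1 : ℕ) : ℝ) ^ 2)⁻¹ *
        (2 - 2 * Real.cos (2 * Real.pi * (ω * (h + 1 : ℕ))))) := by positivity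
    linarith

theorem sum_inv_le {T : ℕ} (hT : 4 ≤ T) :
    ∑ h ∈ Finset.range (T ^ 2), (((h + 1 : ℕ) : ℝ))⁻¹ ≤ 3 * Real.log (1 + T) := by
  have hT' : (4 : ℝ) ≤ T := by exact_mod_cast hT
  have h := harmonic_le_one_add_log (T ^ 2)
  unfold harmonic at h
  push_cast at h
  rw [Real.log_pow] at h
  push_cast at h ⊢
  have h1 : 3 / 2 ≤ Real.log (1 + T) := three_halves_le_log_five.trans
    (Real.log_le_log (by norm_num) (by linarith))
  have h2 : Real.log T ≤ Real.log (1 + T) := Real.log_le_log (by linarith) (by linarith)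
  linarith

variable {E : Type*} [NormedAddCommGroup E] [InnerProductSpace ℝ E]

/-- The weight `32 / T` meets an energy of at most `T * M ^ 2`. In the cosine part, the factor `h`
from the increments reduces `h⁻²` to `h⁻¹`, and the harmonic sum costs one logarithm; `27 = 18 *
(1/4) * 2 * 3`. -/
theorem integral_bandWeight_le {T : ℕ} (hT : 4 ≤ T) {f : ℕ → E} (h0 : f 0 = 0)
    (hf : ∀ n, T + 1 ≤ n → f n = 0) {M P : ℝ} (hM : ∀ n, ‖f n‖ ≤ M) (hP0 : 0 ≤ P)
    (hP : ∀ h, ∑ n ∈ Finset.range (h + 1 + (T + 1)), ‖f (n - 1) - f n‖ ≤ P) :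
    ∫ ω in (-(1 / 2) : ℝ)..(1 / 2), bandWeight T ω * crossSpectrum (Finset.range (T + 1)) f f ω ≤
      8 / Real.log (Real.log Real.pi) *
        (32 * M ^ 2 + 27 * logGrowth T * Real.log (1 + T) * (M * P)) := by
  have hT' : (4 : ℝ) ≤ T := by exact_mod_cast hT
  have hM0 : 0 ≤ M := (norm_nonneg _).trans (hM 0)
  have hL := logGrowth_nonneg hT'
  have hc := log_log_pi_pos
  set p := crossSpectrum (Finset.range (T + 1)) f f with hp
  have hpc : Continuous p := continuous_crossSpectrum _ _ _
  have hexp : ∀ ω, bandWeight T ω * p ω = 8 / Real.log (Real.log Real.pi) * (32 / T * p ω +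
      18 * logGrowth T * (1 / 4 * ∑ h ∈ Finset.range (T ^ 2), (((h + 1 : ℕ) : ℝ) ^ 2)⁻¹ *
        ((2 - 2 * Real.cos (2 * Real.pi * (ω * (h + 1 : ℕ)))) * p ω))) := fun ω => by
    unfold bandWeight
    simp only [← mul_assoc]
    rw [← Finset.sum_mul]
    ring
  simp only [hexp]
  rw [intervalIntegral.integral_const_mul, intervalIntegral.integral_add
    (Continuous.intervalIntegrable (by fun_prop) _ _)
    (Continuous.intervalIntegrable (by fun_prop) _ _), intervalIntegral.integral_const_mul,
    intervalIntegral.integral_const_mul, intervalIntegral.integral_const_mul,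
    intervalIntegral.integral_finsetSum fun _ _ => Continuous.intervalIntegrable (by fun_prop) _ _]
  simp only [intervalIntegral.integral_const_mul]
  rw [integral_crossSpectrum]
  have h1 : ∑ n ∈ Finset.range (T + 1), inner ℝ (f n) (f n) ≤ T * M ^ 2 := by
    rw [Finset.sum_range_succ', h0, inner_zero_right, add_zero]
    calc ∑ n ∈ Finset.range T, inner ℝ (f (n + 1)) (f (n + 1))
        ≤ ∑ n ∈ Finset.range T, M ^ 2 := by
          refine Finset.sum_le_sum fun n _ => ?_
          rw [real_inner_self_eq_norm_sq]
          have := hM (n + 1)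
          gcongr
      _ = T * M ^ 2 := by simp
  have h2 : ∑ h ∈ Finset.range (T ^ 2), (((h + 1 : ℕ) : ℝ) ^ 2)⁻¹ *
      ∫ ω in (-(1 / 2) : ℝ)..(1 / 2),
        (2 - 2 * Real.cos (2 * Real.pi * (ω * (h + 1 : ℕ)))) * p ω ≤
      2 * (M * P) * (3 * Real.log (1 + T)) := by
    calc _ ≤ ∑ h ∈ Finset.range (T ^ 2), 2 * (M * P) * (((h + 1 : ℕ) : ℝ))⁻¹ := by
          refine Finset.sum_le_sum fun h _ => ?_
          have := integral_increment_le h0 hf hM (hP h)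
          have hh : (0 : ℝ) < (h + 1 : ℕ) := by positivity
          calc _ ≤ (((h + 1 : ℕ) : ℝ) ^ 2)⁻¹ * (2 * M * ((h + 1 : ℕ) * P)) := by gcongr
            _ = _ := by field_simp
      _ = 2 * (M * P) * ∑ h ∈ Finset.range (T ^ 2), (((h + 1 : ℕ) : ℝ))⁻¹ := by
          rw [Finset.mul_sum]
      _ ≤ _ := by
          have := sum_inv_le hT
          gcongr
  refine mul_le_mul_of_nonneg_left ?_ (by positivity)
  calc _ ≤ 32 / T * (T * M ^ 2) +
        18 * logGrowth T * (1 / 4 * (2 * (M * P) * (3 * Real.log (1 + T)))) := by gcongr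
    _ = _ := by field_simp; ring

end Weight

/-! ### Comparator sequences -/

section Comparator

variable {d : ℕ}

theorem norm_le_maxNorm (u : ℕ → EuclideanSpace ℝ (Fin d)) {T t : ℕ} (ht : t ∈ Finset.Icc 1 T) :
    ‖u t‖ ≤ maxNorm u T := by
  unfold maxNorm
  exact_mod_cast Finset.le_sup (f := fun t => ‖u t‖₊) ht

theorem maxNorm_nonneg (u : ℕ → EuclideanSpace ℝ (Fin d)) (T : ℕ) : 0 ≤ maxNorm u T :=
  NNReal.coe_nonneg _

theorem pathLength_nonneg (u : ℕ → EuclideanSpace ℝ (Fin d)) (T : ℕ) : 0 ≤ pathLength u T :=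
  Finset.sum_nonneg fun _ _ => norm_nonneg _

theorem pathLength_le (u : ℕ → EuclideanSpace ℝ (Fin d)) (T : ℕ) :
    pathLength u T ≤ 2 * maxNorm u T * T := by
  have hM := maxNorm_nonneg u T
  calc pathLength u T ≤ ∑ t ∈ Finset.Icc 2 T, 2 * maxNorm u T := by
        refine Finset.sum_le_sum fun t ht => ?_
        rw [Finset.mem_Icc] at ht
        have h1 := norm_le_maxNorm u (T := T) (t := t) (by simp; omega)
        have h2 := norm_le_maxNorm u (T := T) (t := t - 1) (by simp; omega)
        linarith [norm_sub_le (u t) (u (t - 1))]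
    _ ≤ 2 * maxNorm u T * T := by
        rw [Finset.sum_const, Nat.card_Icc, nsmul_eq_mul, mul_comm]
        gcongr
        omega

/-- The extension by zero of `u_1, …, u_T`. -/
noncomputable def truncate (u : ℕ → EuclideanSpace ℝ (Fin d)) (T n : ℕ) :
    EuclideanSpace ℝ (Fin d) :=
  if n ∈ Finset.Icc 1 T then u n else 0

theorem truncate_of_mem {u : ℕ → EuclideanSpace ℝ (Fin d)} {T n : ℕ} (h : n ∈ Finset.Icc 1 T) :
    truncate u T n = u n := if_pos h

theorem truncate_of_notMem {u : ℕ → EuclideanSpace ℝ (Fin d)} {T n : ℕ}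
    (h : n ∉ Finset.Icc 1 T) : truncate u T n = 0 := if_neg h

theorem norm_truncate_le (u : ℕ → EuclideanSpace ℝ (Fin d)) (T n : ℕ) :
    ‖truncate u T n‖ ≤ maxNorm u T := by
  by_cases h : n ∈ Finset.Icc 1 T
  · rw [truncate_of_mem h]
    exact norm_le_maxNorm u h
  · rw [truncate_of_notMem h, norm_zero]
    exact maxNorm_nonneg u T

/-- Extending by zero adds the two boundary jumps, into `u_1` and out of `u_T`. They are one source
of the `M²` next to `M P`. -/
theorem sum_norm_truncate_sub_le (u : ℕ → EuclideanSpace ℝ (Fin d)) {T : ℕ} (hT : 4 ≤ T) (h : ℕ) :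
    ∑ n ∈ Finset.range (h + 1 + (T + 1)), ‖truncate u T (n - 1) - truncate u T n‖ ≤
      2 * maxNorm u T + pathLength u T := by
  rw [show h + 1 + (T + 1) = h + (T + 2) by omega,
    sum_range_extend (f := fun n => ‖truncate u T (n - 1) - truncate u T n‖) (fun n hn => by
      rw [truncate_of_notMem (by simp; omega), truncate_of_notMem (by simp; omega), sub_zero,
        norm_zero]),
    Finset.sum_range_succ, Finset.range_eq_Ico, Finset.sum_eq_sum_Ico_succ_bot (by omega),
    Finset.sum_eq_sum_Ico_succ_bot (by omega)]
  have hz : truncate u T 0 = 0 := truncate_of_notMem (by simp)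
  have hz' : truncate u T (T + 1) = 0 := truncate_of_notMem (by simp)
  have hmid : ∑ n ∈ Finset.Ico (0 + 1 + 1) (T + 1), ‖truncate u T (n - 1) - truncate u T n‖ =
      pathLength u T := by
    unfold pathLength
    refine Finset.sum_congr (by ext; simp) fun n hn => ?_
    rw [Finset.mem_Icc] at hn
    rw [truncate_of_mem (Finset.mem_Icc.2 (by omega)),
      truncate_of_mem (Finset.mem_Icc.2 (by omega)),
      norm_sub_rev]
  rw [hmid, hz']
  simp only [zero_add, add_tsub_cancel_right, zero_tsub, hz, sub_self, norm_zero, zero_sub,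
    norm_neg, sub_zero]
  linarith [norm_truncate_le u T 1, norm_truncate_le u T T]

theorem sum_truncate {F : Type*} [AddCommMonoid F]
    (u : ℕ → EuclideanSpace ℝ (Fin d)) (T : ℕ) (φ : ℕ → EuclideanSpace ℝ (Fin d) → F)
    (hφ : ∀ n, φ n 0 = 0) :
    ∑ n ∈ Finset.range (T + 1), φ n (truncate u T n) = ∑ n ∈ Finset.Icc 1 T, φ n (u n) := by
  have hsub : Finset.Icc 1 T ⊆ Finset.range (T + 1) := fun n hn => by
    simp at hn ⊢; omega
  rw [← Finset.sum_subset hsub fun n _ hn => by rw [truncate_of_notMem hn, hφ]]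
  exact Finset.sum_congr rfl fun n hn => by rw [truncate_of_mem hn]

theorem half_le_log_mul_log_log {T : ℝ} (hT : 4 ≤ T) :
    1 / 2 ≤ Real.log (1 + T) * Real.log (Real.log (1 + T)) := by
  have h1 : 3 / 2 ≤ Real.log (1 + T) := three_halves_le_log_five.trans
    (Real.log_le_log (by norm_num) (by linarith))
  have h2 : 1 / 3 ≤ Real.log (Real.log (1 + T)) := by
    have e1 := Real.one_sub_inv_le_log_of_pos (x := 3 / 2) (by norm_num)
    have e2 := Real.log_le_log (by norm_num) h1
    norm_num at e1
    linarith
  nlinarith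

/-- The norm of the comparator operator in the Hilbert-Schmidt space, in dual form. -/
theorem exists_comparator_bound :
    ∃ C : ℝ, 0 < C ∧ ∀ (d : ℕ) (g u : ℕ → EuclideanSpace ℝ (Fin d)) (T : ℕ), 4 ≤ T →
      |∑ t ∈ Finset.Icc 1 T, inner ℝ (u t) (g t)| ≤
        C * (Real.log (1 + T) * Real.log (Real.log (1 + T)) *
          √(maxNorm u T ^ 2 + maxNorm u T * pathLength u T)) *
        ‖∑ t ∈ Finset.Icc 1 T, tensorFeature (g t) (t : ℝ)‖ := by
  have hc := log_log_pi_pos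
  -- `182 = 32 * 4 + 27 * 2`: the first term uses `1 ≤ 4 * Y ^ 2`, the second is the cost of the
  -- boundary jumps.
  refine ⟨√(8 / Real.log (Real.log Real.pi) * 182), by positivity, fun d g u T hT => ?_⟩
  have hT' : (4 : ℝ) ≤ T := by exact_mod_cast hT
  have hM := maxNorm_nonneg u T
  have hP := pathLength_nonneg u T
  have hY := half_le_log_mul_log_log hT'
  have hI := integral_bandWeight_le hT (f := truncate u T) (truncate_of_notMem (by simp))
    (fun n hn => truncate_of_notMem (by simp; omega)) (norm_truncate_le u T)
    (by positivity) (sum_norm_truncate_sub_le u hT)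
  set M := maxNorm u T
  set P := pathLength u T
  have hL : logGrowth T * Real.log (1 + T) =
      (Real.log (1 + T) * Real.log (Real.log (1 + T))) ^ 2 := by
    unfold logGrowth
    ring
  set Y := Real.log (1 + T) * Real.log (Real.log (1 + T)) with hYdef
  have hB := hI.trans (b := _) (c := (√(8 / Real.log (Real.log Real.pi) * 182) *
      (Y * √(M ^ 2 + M * P))) ^ 2) (by
    rw [mul_pow, mul_pow, Real.sq_sqrt (by positivity), Real.sq_sqrt (by positivity),
      mul_assoc (27 : ℝ), hL, mul_assoc (8 / Real.log (Real.log Real.pi))]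
    gcongr
    have h1 : 1 ≤ 4 * Y ^ 2 := by nlinarith
    have h2 := mul_le_mul_of_nonneg_right h1 (by positivity : 0 ≤ M ^ 2)
    have h3 : 0 ≤ Y ^ 2 * (M * P) := by positivity
    nlinarith)
  have := sum_inner_le_of_spectral_bound (Finset.range (T + 1)) (truncate u T) (truncate g T)
    (continuous_bandWeight T) (fun ω h0 h => one_le_spectralDensity_mul_bandWeight hT h0 h)
    (by positivity) hB
  rw [sum_truncate g T (fun n x => tensorFeature x (n : ℝ)) (fun n => by
      ext i; simp [tensorFeature]),
    sum_truncate g T (fun n x => inner ℝ (truncate u T n) x) (fun n => inner_zero_right _)] at this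
  rwa [Finset.sum_congr rfl fun n hn => by rw [truncate_of_mem hn]] at this

end Comparator

/-! ### The regret bound -/

section Regret

variable {d : ℕ}

theorem log_pow_four_le {x : ℝ} (hx : 1 ≤ x) : Real.log x ^ 4 ≤ 256 * x := by
  have h := Real.log_le_self (Real.sqrt_nonneg √x)
  rw [Real.log_sqrt (Real.sqrt_nonneg _), Real.log_sqrt (by linarith)] at h
  have h0 := Real.log_nonneg hx
  calc Real.log x ^ 4 ≤ (4 * √√x) ^ 4 := by
        gcongr
        linarith
    _ = 256 * (√√x ^ 2) ^ 2 := by ring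
    _ = 256 * x := by rw [Real.sq_sqrt (Real.sqrt_nonneg _), Real.sq_sqrt (by linarith)]

theorem one_le_logFactor {M ε : ℝ} (hM : 0 ≤ M) (hε : 0 < ε) (T : ℕ) : 1 ≤ logFactor M ε T := by
  unfold logFactor
  rw [Real.le_log_iff_exp_le (by positivity)]
  linarith [show 0 ≤ M * (T : ℝ) ^ 2 / ε by positivity]

/-- The logarithmic factor of the static regret bound. -/
theorem log_le_logFactor {C ε : ℝ} (hC : 0 < C) (hε : 0 < ε)
    (u : ℕ → EuclideanSpace ℝ (Fin d)) {T : ℕ} (hT : 4 ≤ T) {V : ℝ} (hV1 : 4 ≤ V)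
    (hV : V ≤ 4 + T) :
    Real.log (1 + C * (Real.log (1 + T) * Real.log (Real.log (1 + T)) *
          √(maxNorm u T ^ 2 + maxNorm u T * pathLength u T)) / ε * (√V * Real.log V ^ 2)) ≤
      (1 + Real.log (1 + 2048 * C)) * logFactor (maxNorm u T) ε T := by
  have hT' : (4 : ℝ) ≤ T := by exact_mod_cast hT
  have hT0 : (0 : ℝ) < T := by linarith
  have hM := maxNorm_nonneg u T
  have hP := pathLength_nonneg u T
  have hPle := pathLength_le u T
  have hΛ := one_le_logFactor hM hε T
  set M := maxNorm u T
  set P := pathLength u T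
  have hl1 : 0 < Real.log (1 + T) := Real.log_pos (by linarith)
  have hY0 := half_le_log_mul_log_log hT'
  have hlV : 0 ≤ Real.log V := Real.log_nonneg (by linarith)
  have hlT : Real.log (1 + T) ≤ Real.log (4 + T) := Real.log_le_log (by linarith) (by linarith)
  have h1 : Real.log (1 + T) * Real.log (Real.log (1 + T)) ≤ Real.log (4 + T) ^ 2 := by
    rw [sq]
    have := Real.log_le_self hl1.le
    have := hl1.le.trans hlT
    calc _ ≤ Real.log (1 + T) * Real.log (1 + T) := by gcongr
      _ ≤ _ := by gcongr
  have h2 : √(M ^ 2 + M * P) ≤ 2 * M * √T := by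
    rw [Real.sqrt_le_left (by positivity), mul_pow, Real.sq_sqrt hT0.le]
    have := mul_le_mul_of_nonneg_left hPle hM
    nlinarith [sq_nonneg M]
  have h3 : √V ≤ 2 * √T := by
    rw [Real.sqrt_le_left (by positivity), mul_pow, Real.sq_sqrt hT0.le]
    linarith
  have h4 : Real.log V ^ 2 ≤ Real.log (4 + T) ^ 2 := by
    have := Real.log_le_log (by linarith) hV
    gcongr
  have h5 : Real.log (4 + T) ^ 4 ≤ 512 * T :=
    (log_pow_four_le (by linarith)).trans (by linarith)
  -- The power `T ^ 2` in `logFactor` arises here: `√T` from the path length, `√T` from `√V`, and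
  -- `T` from the fourth power of the logarithm.
  have h6 : C * (Real.log (1 + T) * Real.log (Real.log (1 + T)) * √(M ^ 2 + M * P)) / ε *
      (√V * Real.log V ^ 2) ≤ 2048 * C * (M * (T : ℝ) ^ 2 / ε) := by
    calc _ ≤ C * (Real.log (4 + T) ^ 2 * (2 * M * √T)) / ε *
          (2 * √T * Real.log (4 + T) ^ 2) := by gcongr
      _ = 4 * C * M * (√T * √T) / ε * Real.log (4 + T) ^ 4 := by ring
      _ ≤ 4 * C * M * (√T * √T) / ε * (512 * T) := by gcongr
      _ = _ := by rw [Real.mul_self_sqrt hT0.le]; ring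
  set x := M * (T : ℝ) ^ 2 / ε with hx
  have hx0 : 0 ≤ x := by positivity
  have he : 1 ≤ Real.exp 1 := Real.one_le_exp zero_le_one
  calc _ ≤ Real.log ((1 + 2048 * C) * (Real.exp 1 + x)) := by
        refine Real.log_le_log (by positivity) ?_
        nlinarith
    _ = Real.log (1 + 2048 * C) + logFactor M ε T := by
        rw [Real.log_mul (by positivity) (by positivity), logFactor]
    _ ≤ _ := by
        have := Real.log_nonneg (show 1 ≤ 1 + 2048 * C by linarith)
        nlinarith

theorem inner_play (ε G : ℝ) (hG : 0 < G) (g : ℕ → EuclideanSpace ℝ (Fin d)) (t : ℕ) :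
    inner ℝ (g t) (play ε G g t) = ε * (G * √(kernel 0 0)) *
      inner ℝ ((G * √(kernel 0 0))⁻¹ • tensorFeature (g t) (t : ℝ))
        (staticIterate 1 1
          (fun s => (G * √(kernel 0 0))⁻¹ • tensorFeature (g s) (s : ℝ)) t) := by
  have hL : 0 < G * √(kernel 0 0) := mul_pos hG (Real.sqrt_pos.2 kernel_zero_pos)
  rw [play, ← inner_tensorFeature_right, staticIterate_eq_smul hL, inner_smul_right,
    inner_smul_left]
  rw [conj_trivial, mul_assoc ε, mul_inv_cancel_left₀ hL.ne']

theorem regret_le_of_static {R X Z N κ G ε K B Y : ℝ} (hε : 0 < ε)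
    (hR : R = ε * (G * κ) * X - Z) (hZ : -(B * (G * κ * N)) ≤ Z) (hL : 0 ≤ G * κ)
    (hX : X + B / ε * N ≤ K + 6 * (B / ε) * Y) :
    R ≤ κ * K * (ε * G) + 6 * κ * B * (G * Y) := by
  have h1 := mul_le_mul_of_nonneg_left hX (by positivity : 0 ≤ ε * (G * κ))
  have h2 : ε * (G * κ) * (K + 6 * (B / ε) * Y) =
    κ * K * (ε * G) + 6 * κ * B * (G * Y) := by field_simp
  have h3 : ε * (G * κ) * (B / ε * N) = B * (G * κ * N) := by field_simp
  linarith

theorem sqrt_mul_add_mul_le {G A V l C Λ : ℝ} (hG : 0 < G) (hA : 0 ≤ A)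
    (hVA : G ^ 2 * V = 4 * G ^ 2 + A) (hl0 : 0 ≤ l) (hΛ : 1 ≤ Λ) (hC : 1 ≤ C) (hl : l ≤ C * Λ) :
    G * (√(V * l) + l) ≤ 3 * C * (√A * √Λ + G * Λ) := by
  have e1 : G * √(V * l) = √((4 * G ^ 2 + A) * l) := by
    rw [← hVA, mul_assoc, Real.sqrt_mul (sq_nonneg G), Real.sqrt_sq hG.le]
  have e2 : √(4 * G ^ 2 + A) ≤ 2 * G + √A := by
    rw [Real.sqrt_le_left (by positivity)]
    nlinarith [Real.sq_sqrt hA, mul_nonneg hG.le (Real.sqrt_nonneg A)]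
  have e3 : √l ≤ C * √Λ := by
    rw [Real.sqrt_le_left (by positivity), mul_pow, Real.sq_sqrt (by linarith)]
    nlinarith
  have e4 : √Λ ≤ Λ := by
    rw [Real.sqrt_le_left (by linarith)]
    nlinarith
  have e5 : √(4 * G ^ 2 + A) * √l ≤ (2 * G + √A) * (C * √Λ) := by gcongr
  have e6 : C * (G * √Λ) ≤ C * (G * Λ) := by gcongr
  have e7 := mul_le_mul_of_nonneg_left hl hG.le
  have e8 : 0 ≤ C * (√A * √Λ) := by positivity
  rw [mul_add, e1, Real.sqrt_mul (by positivity)]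
  linarith

/-- Losses are divided by `G √k(0,0)` and iterates by `ε`. The static bound is then applied with
comparator norm `B / ε`, and undoing the scaling turns `G √V` into `√(4G² + ∑ ‖g_t‖²)`. -/
theorem dynamicRegret_le {C : ℝ}
    (hC : 0 < C) (ε G : ℝ) (hε : 0 < ε) (hG : 0 < G) (g u : ℕ → EuclideanSpace ℝ (Fin d)) (T : ℕ)
    (hT : 4 ≤ T) (hg : ∀ t ∈ Finset.Icc 1 T, ‖g t‖ ≤ G)
    (hu : |∑ t ∈ Finset.Icc 1 T, inner ℝ (u t) (g t)| ≤
        C * (Real.log (1 + T) * Real.log (Real.log (1 + T)) *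
          √(maxNorm u T ^ 2 + maxNorm u T * pathLength u T)) *
        ‖∑ t ∈ Finset.Icc 1 T, tensorFeature (g t) (t : ℝ)‖) :
    dynamicRegret g (play ε G g) u T ≤
      √(kernel 0 0) * (25 / 2 * Real.exp 30 + 18 * C * (1 + Real.log (1 + 2048 * C))) *
        (ε * G + Real.log (1 + T) * Real.log (Real.log (1 + T)) *
          (√((maxNorm u T ^ 2 + maxNorm u T * pathLength u T) *
                ∑ t ∈ Finset.Icc 1 T, ‖g t‖ ^ 2) * √(logFactor (maxNorm u T) ε T) +
            G * √(maxNorm u T ^ 2 + maxNorm u T * pathLength u T) *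
              logFactor (maxNorm u T) ε T)) := by
  have hT' : (4 : ℝ) ≤ T := by exact_mod_cast hT
  have hk : 0 < √(kernel 0 0) := Real.sqrt_pos.2 kernel_zero_pos
  have hkk : √(kernel 0 0) ^ 2 = kernel 0 0 := Real.sq_sqrt kernel_zero_pos.le
  have hY := half_le_log_mul_log_log hT'
  set κ := √(kernel 0 0) with hκ
  have hL : 0 < G * κ := mul_pos hG hk
  set Y := Real.log (1 + T) * Real.log (Real.log (1 + T)) with hYdef
  set D := √(maxNorm u T ^ 2 + maxNorm u T * pathLength u T) with hD
  have hD0 : 0 ≤ D := Real.sqrt_nonneg _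
  set Γ : ℕ → OpSpace d := fun s => (G * κ)⁻¹ • tensorFeature (g s) (s : ℝ) with hΓ
  have hΓsq : ∀ t, ‖Γ t‖ ^ 2 = ‖g t‖ ^ 2 / G ^ 2 := fun t => by
    have hk' := kernel_zero_pos
    simp only [hΓ, norm_smul, norm_inv, Real.norm_eq_abs, abs_of_pos hL]
    rw [mul_pow, norm_tensorFeature_sq, inv_pow, mul_pow, hkk]
    field_simp
  have hΓ1 : ∀ t ∈ Finset.Icc 1 T, ‖Γ t‖ ≤ 1 := fun t ht => by
    have h1 := hg t ht
    rw [← abs_of_nonneg (norm_nonneg (Γ t)), ← sq_le_one_iff_abs_le_one, hΓsq,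
      div_le_one (by positivity)]
    gcongr
  set V := 4 + ∑ s ∈ Finset.Icc 1 T, ‖Γ s‖ ^ 2 with hV
  have hVle : V ≤ 4 + T := by
    have : ∑ s ∈ Finset.Icc 1 T, ‖Γ s‖ ^ 2 ≤ ∑ s ∈ Finset.Icc 1 T, (1 : ℝ) :=
      Finset.sum_le_sum fun t ht => by
        rw [sq_le_one_iff_abs_le_one, abs_of_nonneg (norm_nonneg (Γ t))]
        exact hΓ1 t ht
    simp at this
    linarith
  have hV4 : 4 ≤ V := by
    have : 0 ≤ ∑ s ∈ Finset.Icc 1 T, ‖Γ s‖ ^ 2 := Finset.sum_nonneg fun _ _ => sq_nonneg _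
    linarith
  set A := ∑ t ∈ Finset.Icc 1 T, ‖g t‖ ^ 2 with hA
  have hA0 : 0 ≤ A := Finset.sum_nonneg fun _ _ => sq_nonneg _
  have hVA : G ^ 2 * V = 4 * G ^ 2 + A := by
    rw [hV, hA]
    simp only [hΓsq, ← Finset.sum_div]
    field_simp
  set B := C * (Y * D) with hB
  have hB0 : 0 ≤ B := by positivity
  have hstat := static_regret Γ T hΓ1 (b := B / ε) (V := V) (by positivity) hV rfl
  have hlog := log_le_logFactor hC hε u hT hV4 hVle
  rw [← hYdef, ← hD, ← hB] at hlog
  have hΛ := one_le_logFactor (maxNorm_nonneg u T) hε T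
  set Λ := logFactor (maxNorm u T) ε T with hΛdef
  set l := Real.log (1 + B / ε * (√V * Real.log V ^ 2)) with hl
  have hl0 : 0 ≤ l := Real.log_nonneg (by
    linarith [show 0 ≤ B / ε * (√V * Real.log V ^ 2) by positivity])
  have hC1' := Real.log_nonneg (show 1 ≤ 1 + 2048 * C by linarith)
  set C1 := 1 + Real.log (1 + 2048 * C) with hC1
  have hC11 : 1 ≤ C1 := by linarith
  have hsum : ‖∑ s ∈ Finset.Icc 1 T, tensorFeature (g s) (s : ℝ)‖ =
      G * κ * ‖∑ s ∈ Finset.Icc 1 T, Γ s‖ := by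
    simp only [hΓ, ← Finset.smul_sum, norm_smul, norm_inv, Real.norm_eq_abs, abs_of_pos hL]
    field_simp
  have hreg : dynamicRegret g (play ε G g) u T =
      ε * (G * κ) * (∑ t ∈ Finset.Icc 1 T, inner ℝ (Γ t) (staticIterate 1 1 Γ t)) -
        ∑ t ∈ Finset.Icc 1 T, inner ℝ (u t) (g t) := by
    unfold dynamicRegret
    rw [Finset.sum_sub_distrib, Finset.mul_sum]
    congr 1
    · exact Finset.sum_congr rfl fun t _ => inner_play ε G hG g t
    · exact Finset.sum_congr rfl fun t _ => real_inner_comm _ _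
  have hcomp := (abs_le.1 hu).1
  rw [hsum] at hcomp
  have hmain := regret_le_of_static hε hreg hcomp hL.le hstat
  have hfin := sqrt_mul_add_mul_le hG hA0 hVA hl0 hΛ hC11 hlog
  have hsplit : √((maxNorm u T ^ 2 + maxNorm u T * pathLength u T) * A) = D * √A :=
    Real.sqrt_mul (add_nonneg (sq_nonneg _)
      (mul_nonneg (maxNorm_nonneg u T) (pathLength_nonneg u T))) _
  rw [hsplit]
  clear_value κ Y D A Λ C1 l V B
  subst hB
  calc dynamicRegret g (play ε G g) u T
      ≤ κ * (25 / 2 * Real.exp 30) * (ε * G) +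
        6 * κ * (C * (Y * D)) * (3 * C1 * (√A * √Λ + G * Λ)) :=
        hmain.trans (add_le_add_right (mul_le_mul_of_nonneg_left hfin (by positivity)) _)
    _ = κ * (25 / 2 * Real.exp 30) * (ε * G) +
        κ * (18 * C * C1) * (Y * (D * √A * √Λ + G * D * Λ)) := by ring
    _ ≤ κ * (25 / 2 * Real.exp 30 + 18 * C * C1) * (ε * G) +
        κ * (25 / 2 * Real.exp 30 + 18 * C * C1) * (Y * (D * √A * √Λ + G * D * Λ)) := by
        gcongr
        · linarith [show 0 ≤ 18 * C * C1 by positivity]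
        · linarith [Real.exp_pos 30]
    _ = _ := by ring

theorem staticIterate_congr {E : Type*} [NormedAddCommGroup E] [InnerProductSpace ℝ E]
    (ε L : ℝ) (Γ Γ' : ℕ → E) (t : ℕ) (h : ∀ s ∈ Finset.Ico 1 t, Γ s = Γ' s) :
    staticIterate ε L Γ t = staticIterate ε L Γ' t := by
  have h2 : ∀ s ∈ Finset.Ico 1 t, ‖Γ s‖ ^ 2 = ‖Γ' s‖ ^ 2 := fun s hs => by rw [h s hs]
  unfold staticIterate
  rw [Finset.sum_congr rfl h, Finset.sum_congr rfl h2]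

theorem play_congr (ε G : ℝ) (g g' : ℕ → EuclideanSpace ℝ (Fin d)) (t : ℕ)
    (h : ∀ s, 1 ≤ s → s < t → g s = g' s) : play ε G g t = play ε G g' t := by
  refine congrArg (evalOp · (t : ℝ)) (staticIterate_congr _ _ _ _ _ fun s hs => ?_)
  rw [Finset.mem_Ico] at hs
  rw [h s hs.1 hs.2]

end Regret

end KernelOLO

theorem mainTheorem1 :
    -- the algorithm is causal: the play in round `t` depends only on `g_1, …, g_{t-1}`
    (∀ (d : ℕ) (ε G : ℝ) (g g' : ℕ → EuclideanSpace ℝ (Fin d)) (t : ℕ),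
      (∀ s, 1 ≤ s → s < t → g s = g' s) →
      KernelOLO.play ε G g t = KernelOLO.play ε G g' t) ∧
    -- the regret bound, with an absolute constant
    ∃ C : ℝ, 0 < C ∧
      ∀ (d : ℕ) (ε G : ℝ), 0 < ε → 0 < G →
      ∀ (g u : ℕ → EuclideanSpace ℝ (Fin d)) (T : ℕ), 3 < T →
      (∀ t ∈ Finset.Icc 1 T, ‖g t‖ ≤ G) →
      KernelOLO.dynamicRegret g (KernelOLO.play ε G g) u T ≤
        C * (ε * G +
          Real.log (1 + T) * Real.log (Real.log (1 + T)) *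
            (√((KernelOLO.maxNorm u T ^ 2 + KernelOLO.maxNorm u T * KernelOLO.pathLength u T) *
                  ∑ t ∈ Finset.Icc 1 T, ‖g t‖ ^ 2) *
                √(KernelOLO.logFactor (KernelOLO.maxNorm u T) ε T) +
              G * √(KernelOLO.maxNorm u T ^ 2 +
                  KernelOLO.maxNorm u T * KernelOLO.pathLength u T) *
                KernelOLO.logFactor (KernelOLO.maxNorm u T) ε T)) := by
  refine ⟨fun d ε G g g' t h => KernelOLO.play_congr ε G g g' t h, ?_⟩
  obtain ⟨C, hC, hb⟩ := KernelOLO.exists_comparator_bound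
  have hk := Real.sqrt_pos.2 KernelOLO.kernel_zero_pos
  have hl := Real.log_nonneg (show 1 ≤ 1 + 2048 * C by linarith)
  exact ⟨_, by positivity, fun d ε G hε hG g u T hT hg =>
    KernelOLO.dynamicRegret_le hC ε G hε hG g u T hT hg (hb d g u T hT)⟩
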